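/- Let $d,p\ge 0$ and $J\ge 1$ be integers, let $s_1,\dots,s_J\in\mathbb{R}^d$ be the support points, and let $g:\mathbb{R}^d\times\mathbb{R}^p\to\mathbb{R}^p$ be the moment function. Write $g_j=g(s_j,\beta)$ and $H_\beta=(g_1-g_J,\dots,g_{J-1}-g_J)\in\mathbb{R}^{p\times(J-1)}$. Let $\Theta_\beta\subseteq\mathbb{R}^p$ be a Borel set such that, at every $\beta\in\Theta_\beta$, each $g(s_j,\cdot)$ is continuously differentiable in a neighbourhood of $\beta$ and $H_\beta$ has full row rank $p$. Let $$\Theta_{\beta,\theta}=\Big\{(\beta,\theta)\in\Theta_\beta\times\mathbb{R}^{J-1}:\ \theta_j>0\ (1\le j\le J-1),\ \sum_{j<J}\theta_j<1,\ H_\beta\theta+g_J=0\Big\}\subset\mathbb{R}^{p+J-1}.$$ The moment conditions $H_\beta\theta+g_J=0$ are the same as $\sum_{j=1}^J\theta_j\,g(s_j,\beta)=0$ with $\theta_J=1-\sum_{j<J}\theta_j$. Assume that at every $(\beta,\theta)\in\Theta_{\beta,\theta}$ the moment conditions determine $\beta$ locally as a function of $\theta$ with Jacobian $J_\theta=\partial\beta/\partial\theta'\in\mathbb{R}^{p\times(J-1)}$: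 there is a function $b$ with $b(\theta)=\beta$ and $H_{b(\vartheta)}\vartheta+g_J(b(\vartheta))=0$ for all $\vartheta$ near $\theta$, differentiable at $\theta$ with derivative $J_\theta$. Hausdorff measures $\mathcal{H}^k$ are taken with respect to the Euclidean distance and normalized so that $\mathcal{H}^k$ is Lebesgue measure on $\mathbb{R}^k$. Let $(\beta,\theta)$ be a random vector in $\mathbb{R}^p\times\mathbb{R}^{J-1}$ such that $\beta$ has density $p(\beta)$ with respect to Lebesgue measure and, for almost every value of $\beta$ in $\Theta_\beta$, the conditional law of $\theta$ given $\beta$ has density $p(\theta\mid\beta)$, jointly measurable in $(\beta,\theta)$, with respect to $\mathcal{H}^{J-1-p}$ on the affine slice $\{\theta\in\mathbb{R}^{J-1}: H_\beta\theta+g_J=0\}$. Then on $\Theta_{\beta,\theta}$ the law of $(\beta,\theta)$ has a density with respect to $\mathcal{H}^{J-1}$, namely $$p(\beta,\theta)=\frac{|J_\theta J_\theta'|^{1/2}}{|J_\theta J_\theta'+I_p|^{1/2}}\;p(\beta)\,p(\theta\mid\beta),$$ that is, $\mathbb{P}\{(\beta,\theta)\in A\}=\int_A p(\beta,\theta)\,d\mathcal{H}^{J-1}$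 for every Borel set $A\subseteq\Theta_{\beta,\theta}$, and every such density agrees with this one $\mathcal{H}^{J-1}$-almost everywhere on $\Theta_{\beta,\theta}$. In particular, if $(\beta,\theta)\in\Theta_{\beta,\theta}$ almost surely, this is the density of $(\beta,\theta)$ with respect to $\mathcal{H}^{J-1}$ on $\Theta_{\beta,\theta}$. -/

import Mathlib

open MeasureTheory ProbabilityTheory
open scoped ENNReal Topology Matrix

noncomputable section

namespace MomentModel

/-- `ℝ^k` with its Euclidean norm. -/
abbrev E (k : ℕ) : Type := EuclideanSpace ℝ (Fin k)

/-- `ℝ^p × ℝ^m` with its Euclidean norm, that is `ℝ^(m+p)`, in which the pairs `(β, θ)` live. -/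
abbrev Joint (p m : ℕ) : Type := WithLp 2 (E p × E m)

/-- The pair `(β, θ)` as a point of `ℝ^p × ℝ^m` with its Euclidean norm. -/
def pair {p m : ℕ} (β : E p) (θ : E m) : Joint p m := WithLp.toLp 2 (β, θ)

/-- The open simplex `{θ ∈ ℝ^m : θ_j > 0 for all j, θ_1 + ... + θ_m < 1}`, where `m = J - 1`. -/
def simplex (m : ℕ) : Set (E m) := {θ | (∀ j, 0 < θ j) ∧ ∑ j, θ j < 1}

variable {d p m : ℕ}

/-- The `p × (J-1)` matrix `H_β = (g_1, ..., g_{J-1}) - g_J ι'`, where `g_j = g (s_j) β` and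
`J = m + 1`. -/
def H (g : E d → E p → E p) (s : Fin (m + 1) → E d) (β : E p) : Matrix (Fin p) (Fin m) ℝ :=
  Matrix.of fun i j => g (s j.castSucc) β i - g (s (Fin.last m)) β i

/-- The moment conditions `H_β θ + g_J = 0`. -/
def MomentCondition (g : E d → E p → E p) (s : Fin (m + 1) → E d) (β : E p) (θ : E m) : Prop :=
  ∀ i, (H g s β *ᵥ (fun j => θ j)) i + g (s (Fin.last m)) β i = 0

/-- The moment conditions are `∑_{j=1}^J θ_j g(s_j, β) = 0` with `θ_J = 1 - ∑_{j<J} θ_j`. -/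
theorem momentCondition_iff (g : E d → E p → E p) (s : Fin (m + 1) → E d) (β : E p) (θ : E m) :
    MomentCondition g s β θ ↔
      ∑ j : Fin m, θ j • g (s j.castSucc) β + (1 - ∑ j, θ j) • g (s (Fin.last m)) β = 0 := by
  have key : ∀ i, (H g s β *ᵥ (fun j => θ j)) i + g (s (Fin.last m)) β i =
      (∑ j : Fin m, θ j • g (s j.castSucc) β + (1 - ∑ j, θ j) • g (s (Fin.last m)) β) i := by
    intro i
    simp only [H, Matrix.mulVec, dotProduct, Matrix.of_apply, PiLp.add_apply, PiLp.smul_apply,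
      WithLp.ofLp_sum, Finset.sum_apply, smul_eq_mul, sub_mul, Finset.sum_sub_distrib, one_mul,
      Finset.sum_mul]
    have h : ∀ a b : ℝ, a * b = b * a := mul_comm
    simp only [h (g _ _ _)]
    ring
  constructor
  · intro h
    ext i
    rw [← key i, h i]
    rfl
  · intro h i
    rw [key i, h]
    rfl

/-- The affine slice `{θ ∈ ℝ^(J-1) : H_β θ + g_J = 0}`. -/
def slice (g : E d → E p → E p) (s : Fin (m + 1) → E d) (β : E p) : Set (E m) :=
  {θ | MomentCondition g s β θ}

/-- The parameter space `Θ_{β,θ}`: the pairs `(β, θ)` with `β ∈ Θ_β` and `θ` in the open simplex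
that satisfy the moment conditions. -/
def paramSpace (g : E d → E p → E p) (s : Fin (m + 1) → E d) (Θβ : Set (E p)) :
    Set (Joint p m) :=
  {x | x.fst ∈ Θβ ∧ x.snd ∈ simplex m ∧ MomentCondition g s x.fst x.snd}

/-- `A = ∂β/∂θ'` at `(β, θ)`: near `θ` the moment conditions have a solution `θ' ↦ b θ'` through
`(β, θ)`, and `A` is its Jacobian matrix at `θ`. -/
def IsBetaJacobian (g : E d → E p → E p) (s : Fin (m + 1) → E d) (β : E p) (θ : E m)
    (A : Matrix (Fin p) (Fin m) ℝ) : Prop :=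
  ∃ b : E m → E p, b θ = β ∧ (∀ᶠ θ' in 𝓝 θ, MomentCondition g s (b θ') θ') ∧
    HasFDerivAt b (LinearMap.toContinuousLinearMap (Matrix.toEuclideanLin A)) θ

/-- The factor `|A A'|^(1/2) / |A A' + I_p|^(1/2)`. -/
def jacobianFactor (A : Matrix (Fin p) (Fin m) ℝ) : ℝ :=
  Real.sqrt (A * Aᵀ).det / Real.sqrt (A * Aᵀ + 1).det

/-- The joint density `|J_θ J_θ'|^(1/2) / |J_θ J_θ' + I_p|^(1/2) · p(β) p(θ|β)`. -/
def jointDensity (Jθ : E p → E m → Matrix (Fin p) (Fin m) ℝ) (pβ : E p → ℝ≥0∞)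
    (pcond : E p → E m → ℝ≥0∞) (x : Joint p m) : ℝ≥0∞ :=
  ENNReal.ofReal (jacobianFactor (Jθ x.fst x.snd)) * (pβ x.fst * pcond x.fst x.snd)

end MomentModel

end

/-! ### Area formula for injective immersions into a space of possibly larger dimension. -/

section AreaFormula

open Module Set Filter Metric
open scoped NNReal Pointwise

/-! Near each `β₀ ∈ Θβ` the parameter space has a chart. Full row rank splits `ℝ^m` as `ℝ^p × ker
H_{β₀}`, and with `t` the kernel coordinate of `θ`, the map `θ ↦ (H_β θ, t)` stays invertible for
`β` near `β₀`. So `β` and `t` determine the solution `θ` of the moment conditions (`chart`). For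
fixed `β` this parametrizes the slice affinely, with derivative `N` in `t`; jointly, `(β, t) ↦ (β,
θ)` is an injective immersion onto the part of the parameter space over a neighbourhood of `β₀`,
with derivative `D`.

The area formula, applied to both parametrizations, turns the probability of `A` into the integral
of `normDet N · p(β) p(θ|β)` over `(β, t)`, and the `ℋ^m`-integral of the claimed density into that
of `normDet D · factor · p(β) p(θ|β)`. It remains to prove `normDet D · factor = normDet N`
(`normDet_mul_jacobianFactor`). Implicit differentiation shows that the derivative `Q` of the chart
is inverse to `(J, L)`, where `J = J_θ` and `L` takes the coordinate `t`. Hence `D = G ∘ Q` with `G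
z = (J z, z)` and `normDet G = |J J' + I|^(1/2)`, while orthogonality of `ker J` and the range of
`J'` gives `normDet N = normDet Q · |J J'|^(1/2)`.

Countably many charts suffice, by the Lindelöf property. -/

/-- If `f` contracts distances at most `C` times more than `g`, then images of `f` have Hausdorff
measure at most `C ^ d` times that of the images of `g`. -/
theorem MeasureTheory.Measure.euclideanHausdorffMeasure_image_le_of_edist_le {X Y Z : Type*}
    [EMetricSpace Y] [MeasurableSpace Y] [BorelSpace Y]
    [EMetricSpace Z] [MeasurableSpace Z] [BorelSpace Z] {f : X → Y} {g : X → Z} {s : Set X}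
    {C : ℝ≥0} (h : ∀ x ∈ s, ∀ y ∈ s, edist (f x) (f y) ≤ C * edist (g x) (g y)) (d : ℕ) :
    μHE[d] (f '' s) ≤ (C : ℝ≥0∞) ^ d * μHE[d] (g '' s) := by
  rcases s.eq_empty_or_nonempty with rfl | ⟨x₀, hx₀⟩
  · simp
  have : Nonempty X := ⟨x₀⟩
  have hinv : ∀ z ∈ g '' s, Function.invFunOn g s z ∈ s ∧ g (Function.invFunOn g s z) = z :=
    fun z hz => Function.invFunOn_pos hz
  -- Points identified by `g` are identified by `f`, so on `s` the map `f` factors through `g`, by a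
  -- `C`-Lipschitz map.
  have himage : f '' s = (f ∘ Function.invFunOn g s) '' (g '' s) := by
    rw [image_image]
    refine image_congr fun x hx => ?_
    have hx' := hinv (g x) (mem_image_of_mem g hx)
    have h0 := h x hx _ hx'.1
    rw [hx'.2, edist_self, mul_zero, nonpos_iff_eq_zero, edist_eq_zero] at h0
    exact h0
  have hlip : LipschitzOnWith C (f ∘ Function.invFunOn g s) (g '' s) := by
    intro z hz w hw
    refine (h _ (hinv z hz).1 _ (hinv w hw).1).trans ?_
    rw [(hinv z hz).2, (hinv w hw).2]
  have hle := hlip.hausdorffMeasure_image_le (d := d) (by positivity)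
  rw [ENNReal.rpow_natCast] at hle
  simp only [euclideanHausdorffMeasure_def, Measure.smul_apply, himage]
  rw [mul_smul_comm]
  gcongr

/-- If a differentiable function `f` is approximated by a linear map `A` on a set `s`, up to `δ`,
then at almost every `x` in `s` one has `‖f' x - A‖ ≤ δ`. The codomain is arbitrary here. -/
theorem ApproximatesLinearOn.norm_fderiv_sub_le_of_codomain {E F : Type*}
    [NormedAddCommGroup E] [NormedSpace ℝ E] [FiniteDimensional ℝ E]
    [NormedAddCommGroup F] [NormedSpace ℝ F] [MeasurableSpace E] [BorelSpace E]
    (μ : Measure E) [μ.IsAddHaarMeasure] {f : E → F} {s : Set E} {A : E →L[ℝ] F} {δ : ℝ≥0}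
    (hf : ApproximatesLinearOn f A s δ) (hs : MeasurableSet s) (f' : E → E →L[ℝ] F)
    (hf' : ∀ x ∈ s, HasFDerivWithinAt f (f' x) s x) : ∀ᵐ x ∂μ.restrict s, ‖f' x - A‖₊ ≤ δ := by
  filter_upwards [Besicovitch.ae_tendsto_measure_inter_div μ s, ae_restrict_mem hs]
  intro x hx xs
  apply ContinuousLinearMap.opNorm_le_bound _ δ.2 fun z => ?_
  suffices H : ∀ ε, 0 < ε → ‖(f' x - A) z‖ ≤ (δ + ε) * (‖z‖ + ε) + ‖f' x - A‖ * ε by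
    have :
      Tendsto (fun ε : ℝ => ((δ : ℝ) + ε) * (‖z‖ + ε) + ‖f' x - A‖ * ε) (𝓝[>] 0)
        (𝓝 ((δ + 0) * (‖z‖ + 0) + ‖f' x - A‖ * 0)) :=
      Tendsto.mono_left (Continuous.tendsto (by fun_prop) 0) nhdsWithin_le_nhds
    simp only [add_zero, mul_zero] at this
    apply le_of_tendsto_of_tendsto tendsto_const_nhds this
    filter_upwards [self_mem_nhdsWithin]
    exact H
  intro ε εpos
  -- At a density point `x` of `s`, small copies `x + r B(z, ε)` meet `s`, so every direction `z` is
  -- nearly attained by increments inside `s`.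
  have B₁ : ∀ᶠ r in 𝓝[>] (0 : ℝ), (s ∩ ({x} + r • closedBall z ε)).Nonempty :=
    Measure.eventually_nonempty_inter_smul_of_density_one μ s x hx _ measurableSet_closedBall
      (measure_closedBall_pos μ z εpos).ne'
  obtain ⟨ρ, ρpos, hρ⟩ :
    ∃ ρ > 0, ball x ρ ∩ s ⊆ {y : E | ‖f y - f x - (f' x) (y - x)‖ ≤ ε * ‖y - x‖} :=
    mem_nhdsWithin_iff.1 ((hf' x xs).isLittleO.def εpos)
  have B₂ : ∀ᶠ r in 𝓝[>] (0 : ℝ), {x} + r • closedBall z ε ⊆ ball x ρ := by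
    apply nhdsWithin_le_nhds
    exact eventually_singleton_add_smul_subset isBounded_closedBall (ball_mem_nhds x ρpos)
  obtain ⟨r, ⟨y, ⟨ys, hy⟩⟩, rρ, rpos⟩ :
    ∃ r : ℝ,
      (s ∩ ({x} + r • closedBall z ε)).Nonempty ∧ {x} + r • closedBall z ε ⊆ ball x ρ ∧ 0 < r :=
    (B₁.and (B₂.and self_mem_nhdsWithin)).exists
  obtain ⟨a, az, ya⟩ : ∃ a, a ∈ closedBall z ε ∧ y = x + r • a := by
    simp only [mem_smul_set, image_add_left, mem_preimage, singleton_add] at hy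
    rcases hy with ⟨a, az, ha⟩
    exact ⟨a, az, by simp only [ha, add_neg_cancel_left]⟩
  have norm_a : ‖a‖ ≤ ‖z‖ + ε :=
    calc
      ‖a‖ = ‖z + (a - z)‖ := by simp only [add_sub_cancel]
      _ ≤ ‖z‖ + ‖a - z‖ := norm_add_le _ _
      _ ≤ ‖z‖ + ε := by grw [mem_closedBall_iff_norm.1 az]
  have I : r * ‖(f' x - A) a‖ ≤ r * (δ + ε) * (‖z‖ + ε) :=
    calc
      r * ‖(f' x - A) a‖ = ‖(f' x - A) (r • a)‖ := by
        simp only [map_smul, norm_smul, Real.norm_eq_abs, abs_of_nonneg rpos.le]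
      _ = ‖f y - f x - A (y - x) - (f y - f x - (f' x) (y - x))‖ := by
        simp only [ya, add_sub_cancel_left, sub_sub_sub_cancel_left, FunLike.coe_sub,
          Pi.sub_apply, map_smul, smul_sub]
      _ ≤ ‖f y - f x - A (y - x)‖ + ‖f y - f x - (f' x) (y - x)‖ := norm_sub_le _ _
      _ ≤ δ * ‖y - x‖ + ε * ‖y - x‖ := (add_le_add (hf _ ys _ xs) (hρ ⟨rρ hy, ys⟩))
      _ = r * (δ + ε) * ‖a‖ := by
        simp only [ya, add_sub_cancel_left, norm_smul, Real.norm_eq_abs, abs_of_nonneg rpos.le]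
        ring
      _ ≤ r * (δ + ε) * (‖z‖ + ε) := by gcongr
  calc
    ‖(f' x - A) z‖ = ‖(f' x - A) a + (f' x - A) (z - a)‖ := by
      congr 1
      simp only [FunLike.coe_sub, map_sub, Pi.sub_apply]
      abel
    _ ≤ ‖(f' x - A) a‖ + ‖(f' x - A) (z - a)‖ := norm_add_le _ _
    _ ≤ (δ + ε) * (‖z‖ + ε) + ‖f' x - A‖ * ‖z - a‖ := by
      apply add_le_add
      · rw [mul_assoc] at I; exact (mul_le_mul_iff_right₀ rpos).1 I
      · apply ContinuousLinearMap.le_opNorm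
    _ ≤ (δ + ε) * (‖z‖ + ε) + ‖f' x - A‖ * ε := by
      rw [mem_closedBall_iff_norm'] at az
      gcongr

/-- The derivative of a function on a measurable set is almost everywhere measurable on this set,
for an arbitrary codomain. -/
theorem MeasureTheory.aemeasurable_fderivWithin_of_codomain {E F : Type*}
    [NormedAddCommGroup E] [NormedSpace ℝ E] [FiniteDimensional ℝ E]
    [NormedAddCommGroup F] [NormedSpace ℝ F] [FiniteDimensional ℝ F]
    [MeasurableSpace E] [BorelSpace E]
    (μ : Measure E) [μ.IsAddHaarMeasure] {f : E → F} {s : Set E} {f' : E → E →L[ℝ] F}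
    (hs : MeasurableSet s) (hf' : ∀ x ∈ s, HasFDerivWithinAt f (f' x) s x) :
    AEMeasurable f' (μ.restrict s) := by
  have : SecondCountableTopology F := secondCountable_of_proper
  refine aemeasurable_of_unif_approx fun ε εpos => ?_
  let δ : ℝ≥0 := ⟨ε, le_of_lt εpos⟩
  have δpos : 0 < δ := εpos
  -- The derivative is a.e. within `δ` of a function that is constant on each piece of a countable
  -- measurable partition.
  obtain ⟨t, A, t_disj, t_meas, t_cover, ht, -⟩ :=
    exists_partition_approximatesLinearOn_of_hasFDerivWithinAt f s f' hf' (fun _ => δ) fun _ =>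
      δpos.ne'
  obtain ⟨g, g_meas, hg⟩ :
      ∃ g : E → E →L[ℝ] F, Measurable g ∧ ∀ (n : ℕ) (x : E), x ∈ t n → g x = A n :=
    exists_measurable_piecewise t t_meas (fun n _ => A n) (fun n => measurable_const) <|
      t_disj.mono fun i j h => by simp only [h.inter_eq, eqOn_empty]
  refine ⟨g, g_meas.aemeasurable, ?_⟩
  suffices H : ∀ᵐ x : E ∂Measure.sum fun n ↦ μ.restrict (s ∩ t n), dist (g x) (f' x) ≤ ε by
    have : μ.restrict s ≤ Measure.sum fun n => μ.restrict (s ∩ t n) := by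
      have : s = ⋃ n, s ∩ t n := by
        rw [← inter_iUnion]
        exact Subset.antisymm (subset_inter Subset.rfl t_cover) inter_subset_left
      conv_lhs => rw [this]
      exact Measure.restrict_iUnion_le
    exact ae_mono this H
  refine Measure.ae_sum_iff.2 fun n => ?_
  have E₁ : ∀ᵐ x : E ∂μ.restrict (s ∩ t n), ‖f' x - A n‖₊ ≤ δ :=
    (ht n).norm_fderiv_sub_le_of_codomain μ (hs.inter (t_meas n)) f' fun x hx =>
      (hf' x hx.1).mono inter_subset_left
  filter_upwards [E₁, ae_restrict_mem (hs.inter (t_meas n))] with x hx1 hx2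
  rw [← nndist_eq_nnnorm] at hx1
  rw [hg n x hx2.2, dist_comm]
  exact hx1

/-- The Gram form `√det(f* f)` is visibly continuous in `f`. This carries measurability from the
derivative to the Jacobian. -/
theorem ContinuousLinearMap.continuous_normDet {U V : Type*}
    [NormedAddCommGroup U] [InnerProductSpace ℝ U] [FiniteDimensional ℝ U]
    [NormedAddCommGroup V] [InnerProductSpace ℝ V] [FiniteDimensional ℝ V] :
    Continuous fun f : U →L[ℝ] V => f.toLinearMap.normDet := by
  have h : (fun f : U →L[ℝ] V => f.toLinearMap.normDet) =
      fun f => Real.sqrt (f.adjoint ∘L f).det := by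
    ext f
    have := f.normDet_sq
    simp only [RCLike.ofReal_real_eq_id, id_eq] at this
    rw [← this, Real.sqrt_sq f.normDet_nonneg]
  rw [h]
  have hadj : Continuous fun f : U →L[ℝ] V => f.adjoint := ContinuousLinearMap.adjoint.continuous
  exact (ContinuousLinearMap.continuous_det.comp (hadj.clm_comp continuous_id)).sqrt

/-- Linear maps that dominate each other up to a factor `C` have norm determinants that dominate
each other up to a factor `C ^ dim`. -/
theorem LinearMap.normDet_le_of_norm_le {U V : Type*}
    [NormedAddCommGroup U] [InnerProductSpace ℝ U] [FiniteDimensional ℝ U]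
    [NormedAddCommGroup V] [InnerProductSpace ℝ V] {A B : U →ₗ[ℝ] V} {C : ℝ≥0}
    (h : ∀ v, ‖B v‖ ≤ C * ‖A v‖) :
    ENNReal.ofReal B.normDet ≤ (C : ℝ≥0∞) ^ finrank ℝ U * ENNReal.ofReal A.normDet := by
  borelize U V
  -- Both images of the unit ball have measure `normDet` times its volume, which is positive and
  -- finite and cancels.
  have hball := Measure.euclideanHausdorffMeasure_image_le_of_edist_le (f := B) (g := A)
    (s := ball 0 1) (C := C) (fun x _ y _ => by
      rw [edist_eq_enorm_sub, edist_eq_enorm_sub, ← map_sub, ← map_sub, enorm_eq_nnnorm,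
        enorm_eq_nnnorm]
      exact_mod_cast h (x - y)) (finrank ℝ U)
  rw [B.euclideanHausdorffMeasure_image_eq_normDet_mul_volume,
    A.euclideanHausdorffMeasure_image_eq_normDet_mul_volume, ← mul_assoc] at hball
  exact (ENNReal.mul_le_mul_iff_left (measure_ball_pos volume _ one_pos).ne'
    measure_ball_lt_top.ne).1 hball

variable {U V : Type*} [NormedAddCommGroup U] [InnerProductSpace ℝ U] [FiniteDimensional ℝ U]
  [MeasurableSpace U] [BorelSpace U] [NormedAddCommGroup V] [InnerProductSpace ℝ V]
  [FiniteDimensional ℝ V] [MeasurableSpace V] [BorelSpace V]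

/-- On a set where `f` is approximated by an injective linear map `A`, up to a small multiple of the
antilipschitz constant of `A`, the Hausdorff measure of the image of `f` and the integral of
`normDet (f' x)` are comparable. -/
theorem ApproximatesLinearOn.image_comparable {f : U → V} {s : Set U} {A : U →L[ℝ] V} {δ : ℝ≥0}
    (hf : ApproximatesLinearOn f A s δ) (hs : MeasurableSet s) {f' : U → U →L[ℝ] V}
    (hf' : ∀ x ∈ s, HasFDerivWithinAt f (f' x) s x) {K : ℝ≥0} (hA : AntilipschitzWith K A)
    {C : ℝ≥0} (hC : 1 < C) (hδ : δ * K ≤ 1 - C⁻¹) :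
    μHE[finrank ℝ U] (f '' s) ≤ ((C : ℝ≥0∞) ^ finrank ℝ U * (C : ℝ≥0∞) ^ finrank ℝ U) *
        ∫⁻ x in s, ENNReal.ofReal (f' x).toLinearMap.normDet ∧
      ∫⁻ x in s, ENNReal.ofReal (f' x).toLinearMap.normDet ≤
        ((C : ℝ≥0∞) ^ finrank ℝ U * (C : ℝ≥0∞) ^ finrank ℝ U) * μHE[finrank ℝ U] (f '' s) := by
  set n := finrank ℝ U
  have hC' : (1 : ℝ) < C := by exact_mod_cast hC
  have hCinv : C⁻¹ ≤ 1 := inv_le_one_of_one_le₀ hC.le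
  have hδ' : (δ : ℝ) * K ≤ 1 - (C : ℝ)⁻¹ := by
    have := NNReal.coe_le_coe.2 hδ
    rwa [NNReal.coe_mul, NNReal.coe_sub hCinv, NNReal.coe_inv, NNReal.coe_one] at this
  have hK : ∀ v, ‖v‖ ≤ K * ‖A v‖ := fun v => by simpa using hA.le_mul_dist v 0
  -- two vectors that differ by at most `δ ‖v‖` have comparable norms
  have hcomp : ∀ (v : U) (w : V), ‖w - A v‖ ≤ δ * ‖v‖ → ‖w‖ ≤ C * ‖A v‖ ∧ ‖A v‖ ≤ C * ‖w‖ := by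
    intro v w hw
    have h1 : ‖w - A v‖ ≤ (1 - (C : ℝ)⁻¹) * ‖A v‖ :=
      calc ‖w - A v‖ ≤ δ * (K * ‖A v‖) := hw.trans (by gcongr; exact hK v)
        _ = (δ * K) * ‖A v‖ := by ring
        _ ≤ _ := by gcongr
    have h2 : ‖w‖ ≤ ‖w - A v‖ + ‖A v‖ := by simpa using norm_add_le (w - A v) (A v)
    have h3 : ‖A v‖ ≤ ‖w - A v‖ + ‖w‖ := by
      have := norm_sub_le w (w - A v)
      rw [sub_sub_cancel] at this
      linarith
    have hpos : (0 : ℝ) < C := by linarith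
    -- The triangle inequality gives `‖w‖ ≤ (2 - C⁻¹) ‖A v‖`, and `2 - C⁻¹ ≤ C`.
    have h4 : (C : ℝ) + (C : ℝ)⁻¹ ≥ 2 := by
      have := sq_nonneg ((C : ℝ) - 1)
      have h5 : (C : ℝ) * (C : ℝ)⁻¹ = 1 := mul_inv_cancel₀ hpos.ne'
      nlinarith [inv_pos.2 hpos]
    constructor
    · nlinarith [norm_nonneg (A v)]
    · have : (C : ℝ)⁻¹ * ‖A v‖ ≤ ‖w‖ := by linarith
      calc ‖A v‖ = C * ((C : ℝ)⁻¹ * ‖A v‖) := by field_simp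
        _ ≤ _ := by gcongr
  have hfA : ∀ x ∈ s, ∀ y ∈ s, ‖f x - f y - A (x - y)‖ ≤ δ * ‖x - y‖ := hf
  have hle₁ : μHE[n] (f '' s) ≤ (C : ℝ≥0∞) ^ n * μHE[n] (A '' s) := by
    refine Measure.euclideanHausdorffMeasure_image_le_of_edist_le (fun x hx y hy => ?_) n
    rw [edist_eq_enorm_sub, edist_eq_enorm_sub, ← map_sub, enorm_eq_nnnorm, enorm_eq_nnnorm]
    exact_mod_cast (hcomp _ _ (hfA x hx y hy)).1
  have hle₂ : μHE[n] (A '' s) ≤ (C : ℝ≥0∞) ^ n * μHE[n] (f '' s) := by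
    refine Measure.euclideanHausdorffMeasure_image_le_of_edist_le (fun x hx y hy => ?_) n
    rw [edist_eq_enorm_sub, edist_eq_enorm_sub, ← map_sub, enorm_eq_nnnorm, enorm_eq_nnnorm]
    exact_mod_cast (hcomp _ _ (hfA x hx y hy)).2
  have hvol : μHE[n] (A '' s) = ∫⁻ _ in s, ENNReal.ofReal A.toLinearMap.normDet := by
    rw [setLIntegral_const]
    exact A.toLinearMap.euclideanHausdorffMeasure_image_eq_normDet_mul_volume s
  have hae := hf.norm_fderiv_sub_le_of_codomain volume hs f' hf'
  have hderiv : ∀ x, ‖f' x - A‖₊ ≤ δ → ∀ v, ‖f' x v - A v‖ ≤ δ * ‖v‖ := fun x hx v => by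
    simpa using (f' x - A).le_of_opNorm_le hx v
  have hmeas : AEMeasurable (fun x => ENNReal.ofReal (f' x).toLinearMap.normDet)
      (volume.restrict s) :=
    (ENNReal.measurable_ofReal.comp
      ContinuousLinearMap.continuous_normDet.measurable).comp_aemeasurable
      (aemeasurable_fderivWithin_of_codomain volume hs hf')
  constructor
  · rw [mul_assoc]
    refine hle₁.trans (mul_le_mul_right ?_ _)
    rw [hvol, ← lintegral_const_mul'' _ hmeas]
    refine lintegral_mono_ae ?_
    filter_upwards [hae] with x hx
    exact LinearMap.normDet_le_of_norm_le fun v => (hcomp _ _ (hderiv x hx v)).2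
  · rw [mul_assoc]
    refine le_trans ?_ (mul_le_mul_right hle₂ _)
    rw [hvol, ← lintegral_const_mul _ measurable_const]
    refine lintegral_mono_ae ?_
    filter_upwards [hae] with x hx
    exact LinearMap.normDet_le_of_norm_le fun v => (hcomp _ _ (hderiv x hx v)).1

/-- **Area formula**: the Hausdorff measure of the image of a measurable set under an injective
immersion. -/
theorem MeasureTheory.lintegral_normDet_fderiv_eq_euclideanHausdorffMeasure_image {f : U → V}
    {s : Set U} (hs : MeasurableSet s) {f' : U → U →L[ℝ] V}
    (hf' : ∀ x ∈ s, HasFDerivWithinAt f (f' x) s x) (hinj : InjOn f s)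
    (hinj' : ∀ x ∈ s, Function.Injective (f' x)) :
    ∫⁻ x in s, ENNReal.ofReal (f' x).toLinearMap.normDet = μHE[finrank ℝ U] (f '' s) := by
  classical
  rcases s.eq_empty_or_nonempty with rfl | hne
  · simp
  set n := finrank ℝ U
  have hcont : ContinuousOn f s := fun x hx => (hf' x hx).continuousWithinAt
  have key : ∀ C : ℝ≥0, 1 < C →
      μHE[n] (f '' s) ≤ ((C : ℝ≥0∞) ^ n * (C : ℝ≥0∞) ^ n) *
        ∫⁻ x in s, ENNReal.ofReal (f' x).toLinearMap.normDet ∧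
      ∫⁻ x in s, ENNReal.ofReal (f' x).toLinearMap.normDet ≤
        ((C : ℝ≥0∞) ^ n * (C : ℝ≥0∞) ^ n) * μHE[n] (f '' s) := by
    intro C hC
    have hε : 0 < 1 - C⁻¹ := tsub_pos_of_lt (inv_lt_one_of_one_lt₀ hC)
    have hanti : ∀ A : U →L[ℝ] V, Function.Injective A → ∃ K : ℝ≥0, 0 < K ∧ AntilipschitzWith K A :=
      fun A hA => A.toLinearMap.exists_antilipschitzWith (LinearMap.ker_eq_bot.2 hA)
    -- The partition needs a positive radius for every `A`. The value `1` at non-injective maps is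
    -- never used, because each `A k` is a derivative at a point of `s`.
    have hr : ∀ A : U →L[ℝ] V, ∃ r : ℝ≥0, r ≠ 0 ∧ (Function.Injective A →
        ∃ K : ℝ≥0, AntilipschitzWith K A ∧ r * K ≤ 1 - C⁻¹) := by
      intro A
      by_cases hA : Function.Injective A
      · obtain ⟨K, hK, hAK⟩ := hanti A hA
        refine ⟨(1 - C⁻¹) / K, (div_pos hε hK).ne', fun _ => ⟨K, hAK, ?_⟩⟩
        rw [div_mul_cancel₀ _ hK.ne']
      · exact ⟨1, one_ne_zero, fun h => absurd h hA⟩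
    choose r hr0 hr using hr
    obtain ⟨t, A, t_disj, t_meas, t_cover, ht, hA⟩ :=
      exists_partition_approximatesLinearOn_of_hasFDerivWithinAt f s f' hf' r hr0
    have hAinj : ∀ k, Function.Injective (A k) := fun k => by
      obtain ⟨y, hy, hyA⟩ := hA hne k
      rw [hyA]
      exact hinj' y hy
    choose K hK hrK using fun k => hr (A k) (hAinj k)
    have hpiece := fun k => (ht k).image_comparable (hs.inter (t_meas k))
      (fun x hx => (hf' x hx.1).mono inter_subset_left) (hK k) hC (hrK k)
    have hs_eq : s = ⋃ k, s ∩ t k := by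
      rw [← inter_iUnion]
      exact Subset.antisymm (subset_inter Subset.rfl t_cover) inter_subset_left
    have hdisj : Pairwise (Function.onFun Disjoint fun k => s ∩ t k) :=
      fun i j hij => (t_disj hij).mono inter_subset_right inter_subset_right
    have hmeas : ∀ k, MeasurableSet (s ∩ t k) := fun k => hs.inter (t_meas k)
    have hint : ∫⁻ x in s, ENNReal.ofReal (f' x).toLinearMap.normDet =
        ∑' k, ∫⁻ x in s ∩ t k, ENNReal.ofReal (f' x).toLinearMap.normDet := by
      conv_lhs => rw [hs_eq]
      exact lintegral_iUnion hmeas hdisj _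
    have himage : μHE[n] (f '' s) = ∑' k, μHE[n] (f '' (s ∩ t k)) := by
      conv_lhs => rw [hs_eq, image_iUnion]
      refine measure_iUnion (fun i j hij => ?_) (fun k => ?_)
      · change Disjoint (f '' (s ∩ t i)) (f '' (s ∩ t j))
        refine disjoint_left.2 ?_
        rintro _ ⟨x, hx, rfl⟩ ⟨y, hy, hxy⟩
        obtain rfl := hinj hy.1 hx.1 hxy
        exact disjoint_left.1 (hdisj hij) hx hy
      -- Lusin–Souslin: injective continuous images of Borel sets are Borel.
      · exact (hmeas k).image_of_continuousOn_injOn (hcont.mono inter_subset_left)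
          (hinj.mono inter_subset_left)
    rw [hint, himage, ← ENNReal.tsum_mul_left, ← ENNReal.tsum_mul_left]
    exact ⟨ENNReal.tsum_le_tsum fun k => (hpiece k).1, ENNReal.tsum_le_tsum fun k => (hpiece k).2⟩
  have hlim : ∀ a : ℝ≥0∞, Tendsto (fun C : ℝ≥0 => ((C : ℝ≥0∞) ^ n * (C : ℝ≥0∞) ^ n) * a) (𝓝[>] 1)
      (𝓝 a) := by
    intro a
    have h1 : Tendsto (fun C : ℝ≥0 => (C : ℝ≥0∞) ^ n * (C : ℝ≥0∞) ^ n) (𝓝[>] 1) (𝓝 1) := by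
      have : Continuous fun C : ℝ≥0 => (((C ^ n * C ^ n : ℝ≥0)) : ℝ≥0∞) := by fun_prop
      have h := (this.tendsto 1).mono_left (nhdsWithin_le_nhds (s := Ioi 1))
      simpa using h
    simpa using ENNReal.Tendsto.mul_const h1 (Or.inl one_ne_zero) (b := a)
  refine le_antisymm (ge_of_tendsto (hlim _) ?_) (ge_of_tendsto (hlim _) ?_)
  · filter_upwards [self_mem_nhdsWithin] with C hC using (key C hC).2
  · filter_upwards [self_mem_nhdsWithin] with C hC using (key C hC).1

/-- **Area formula**, for integrals: an integral over the image of an injective immersion with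
respect to the Hausdorff measure is an integral over the domain. -/
theorem MeasureTheory.lintegral_image_eq_lintegral_normDet_fderiv_mul {f : U → V}
    {s : Set U} (hs : MeasurableSet s) {f' : U → U →L[ℝ] V}
    (hf' : ∀ x ∈ s, HasFDerivWithinAt f (f' x) s x) (hinj : InjOn f s)
    (hinj' : ∀ x ∈ s, Function.Injective (f' x)) (g : V → ℝ≥0∞) :
    ∫⁻ y in f '' s, g y ∂μHE[finrank ℝ U] =
      ∫⁻ x in s, ENNReal.ofReal (f' x).toLinearMap.normDet * g (f x) := by
  have hcont : ContinuousOn f s := fun x hx => (hf' x hx).continuousWithinAt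
  have hemb : MeasurableEmbedding (s.domRestrict f) := hcont.measurableEmbedding hs hinj
  have hmeas : AEMeasurable (fun x => ENNReal.ofReal (f' x).toLinearMap.normDet)
      (volume.restrict s) :=
    (ENNReal.measurable_ofReal.comp
      ContinuousLinearMap.continuous_normDet.measurable).comp_aemeasurable
      (aemeasurable_fderivWithin_of_codomain volume hs hf')
  -- On sets this is the preceding area formula on `s ∩ f ⁻¹' t`. Since `f` is a measurable
  -- embedding on `s`, the integral formula then holds without measurability of `g`.
  have hmap : Measure.map (s.domRestrict f) (Measure.comap (↑)
      (volume.withDensity fun x => ENNReal.ofReal (f' x).toLinearMap.normDet)) =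
      μHE[finrank ℝ U].restrict (f '' s) := by
    ext t ht
    have hset : Subtype.val '' (s.domRestrict f ⁻¹' t) = s ∩ f ⁻¹' t := by
      ext x
      simp [and_comm]
    have hst : MeasurableSet (s ∩ f ⁻¹' t) := by
      rw [← hset]
      exact (MeasurableEmbedding.subtype_coe hs).measurableSet_image.2 (hemb.measurable ht)
    rw [hemb.map_apply, (MeasurableEmbedding.subtype_coe hs).comap_apply, hset,
      withDensity_apply _ hst, Measure.restrict_apply ht,
      lintegral_normDet_fderiv_eq_euclideanHausdorffMeasure_image hst
        (fun x hx => (hf' x hx.1).mono inter_subset_left) (hinj.mono inter_subset_left)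
        (fun x hx => hinj' x hx.1), image_inter_preimage, inter_comm]
  rw [← hmap, hemb.lintegral_map]
  simp only [Set.domRestrict_apply, ← Function.comp_apply (f := g)]
  rw [← (MeasurableEmbedding.subtype_coe hs).lintegral_map, map_comap_subtype_coe hs,
    setLIntegral_withDensity_eq_setLIntegral_mul_non_measurable₀ _ _ _ hs]
  · simp only [Pi.mul_apply]
  · simp only [Filter.eventually_true, ENNReal.ofReal_lt_top]
  · exact hmeas

end AreaFormula

/-! ### The determinant identity behind the Jacobian factor. -/

section NormDet

open Module

variable {X Z W : Type*} [NormedAddCommGroup X] [InnerProductSpace ℝ X] [FiniteDimensional ℝ X]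
  [NormedAddCommGroup Z] [InnerProductSpace ℝ Z] [FiniteDimensional ℝ Z]
  [NormedAddCommGroup W] [InnerProductSpace ℝ W] [FiniteDimensional ℝ W]

/-- If `Q` is the inverse of `(A, L) : Z → X × W`, the norm determinant of `Q` on `W`, which
parametrizes `ker A`, is that of `Q` times that of the adjoint of `A`. -/
theorem LinearMap.normDet_restrict_snd_of_inverse {A : Z →ₗ[ℝ] X} {L : Z →ₗ[ℝ] W}
    {Q : WithLp 2 (X × W) →ₗ[ℝ] Z} {N : W →ₗ[ℝ] Z} (hA : ∀ y, A (Q y) = y.fst)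
    (hQ : ∀ z, Q (WithLp.toLp 2 (A z, L z)) = z) (hN : ∀ t, N t = Q (WithLp.toLp 2 (0, t))) :
    N.normDet = Q.normDet * A.adjoint.normDet := by
  classical
  let bX := stdOrthonormalBasis ℝ X
  let bW := stdOrthonormalBasis ℝ W
  let b := bX.prod bW
  have hQadd : ∀ (z : Z) (t : W), Q (WithLp.toLp 2 (A z, L z + t)) = z + N t := fun z t => by
    rw [hN, ← congrArg (· + Q (WithLp.toLp 2 (0, t))) (hQ z), ← map_add]
    congr 1
    simp [← WithLp.toLp_add]
  -- `S` is block triangular with determinant `det (A A*)`, and `Q ∘ S` sends `(x, t)` to `A* x + N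
  -- t`. Computing `normDet (Q ∘ S)` in two ways gives the claim.
  let S : WithLp 2 (X × W) →ₗ[ℝ] WithLp 2 (X × W) :=
    { toFun := fun y => WithLp.toLp 2 (A (A.adjoint y.fst), L (A.adjoint y.fst) + y.snd)
      map_add' := fun x y => by
        simp only [WithLp.add_fst, WithLp.add_snd, map_add, ← WithLp.toLp_add, Prod.mk_add_mk]
        congr 2
        abel
      map_smul' := fun c y => by
        simp only [WithLp.smul_fst, WithLp.smul_snd, map_smul, ← WithLp.toLp_smul, Prod.smul_mk,
          smul_add, RingHom.id_apply] }
  have hQS : ∀ y, (Q ∘ₗ S) y = A.adjoint y.fst + N y.snd := fun y => hQadd _ _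
  have hS : S.normDet = A.adjoint.normDet ^ 2 := by
    have hmat : LinearMap.toMatrix b.toBasis b.toBasis S = Matrix.fromBlocks
        (LinearMap.toMatrix bX.toBasis bX.toBasis (A ∘ₗ A.adjoint)) 0
        (LinearMap.toMatrix bX.toBasis bW.toBasis (L ∘ₗ A.adjoint)) 1 := by
      ext i j
      rcases i with i | i <;> rcases j with j | j <;>
        simp [LinearMap.toMatrix_apply, b, S, OrthonormalBasis.repr_apply_apply,
          WithLp.prod_inner_apply, Matrix.one_apply, orthonormal_iff_ite.1 bW.orthonormal]
    have hsq := A.adjoint.normDet_sq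
    simp only [RCLike.ofReal_real_eq_id, id_eq, LinearMap.adjoint_adjoint] at hsq
    rw [LinearMap.normDet_eq_norm_det_toMatrix S b b, hmat, Matrix.det_fromBlocks_zero₁₂,
      Matrix.det_one, mul_one, LinearMap.det_toMatrix, ← hsq, Real.norm_of_nonneg (sq_nonneg _)]
  have hgram : (Q ∘ₗ S).normDet ^ 2 = A.adjoint.normDet ^ 2 * N.normDet ^ 2 := by
    have h0 := (Q ∘ₗ S).normDet_sq_eq_det_gram b
    have h1 := A.adjoint.normDet_sq_eq_det_gram bX
    have h2 := N.normDet_sq_eq_det_gram bW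
    simp only [RCLike.ofReal_real_eq_id, id_eq] at h0 h1 h2
    rw [h0, h1, h2, ← Matrix.det_fromBlocks_zero₁₂ _ 0]
    congr 1
    -- `N` maps into `ker A`, orthogonal to the range of `A*`, so the Gram matrix of `Q ∘ S` is
    -- block diagonal.
    have horth : ∀ (x : X) (t : W), inner ℝ (A.adjoint x) (N t) = 0 := fun x t => by
      rw [LinearMap.adjoint_inner_left, hN, hA]
      simp
    have horth' : ∀ (x : X) (t : W), inner ℝ (N t) (A.adjoint x) = 0 := fun x t => by
      rw [real_inner_comm, horth]
    ext i j
    rcases i with i | i <;> rcases j with j | j <;>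
      simp only [Matrix.gram_apply, hQS, Matrix.fromBlocks_apply₁₁, Matrix.fromBlocks_apply₁₂,
        Matrix.fromBlocks_apply₂₁, Matrix.fromBlocks_apply₂₂] <;>
      simp [b, horth, horth']
  have hne : A.adjoint.normDet ≠ 0 := by
    rw [Ne, LinearMap.normDet_eq_zero_iff_ker_ne_bot, not_not, LinearMap.ker_eq_bot']
    intro x hx
    have h := LinearMap.adjoint_inner_left A (Q (WithLp.toLp 2 (x, 0))) x
    rw [hA, hx, inner_zero_left] at h
    exact inner_self_eq_zero.1 h.symm
  rw [LinearMap.normDet_comp_of_finrank_eq _ _ rfl, hS] at hgram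
  have h := A.adjoint.normDet_nonneg
  rw [← sq_eq_sq₀ N.normDet_nonneg (mul_nonneg Q.normDet_nonneg h)]
  refine mul_left_cancel₀ (pow_ne_zero 2 hne) ?_
  rw [← hgram]
  ring

/-- The Jacobian of the parametrization `y ↦ (y.fst, Q y)` of the graph of `J`, where `Q` is the
inverse of `(J, L)`, compared with the Jacobian of `Q` on `W`, which parametrizes `ker J`. -/
theorem MomentModel.normDet_mul_jacobianFactor {p m : ℕ} {J : Matrix (Fin p) (Fin m) ℝ}
    {L : MomentModel.E m →ₗ[ℝ] W}
    {Q : WithLp 2 (MomentModel.E p × W) →ₗ[ℝ] MomentModel.E m} {N : W →ₗ[ℝ] MomentModel.E m}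
    {D : WithLp 2 (MomentModel.E p × W) →ₗ[ℝ] MomentModel.Joint p m}
    (hA : ∀ y, Matrix.toEuclideanLin J (Q y) = y.fst)
    (hL : ∀ y, L (Q y) = y.snd)
    (hQ : ∀ z, Q (WithLp.toLp 2 (Matrix.toEuclideanLin J z, L z)) = z)
    (hN : ∀ t, N t = Q (WithLp.toLp 2 (0, t))) (hD : ∀ y, D y = MomentModel.pair y.fst (Q y)) :
    D.normDet * MomentModel.jacobianFactor J = N.normDet := by
  set A := Matrix.toEuclideanLin J
  let G : MomentModel.E m →ₗ[ℝ] MomentModel.Joint p m :=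
    { toFun := fun z => WithLp.toLp 2 (A z, z)
      map_add' := fun x y => by simp [← WithLp.toLp_add]
      map_smul' := fun c y => by simp [← WithLp.toLp_smul] }
  have hDG : D = G ∘ₗ Q := LinearMap.ext fun y => by
    rw [hD, ← hA y]
    rfl
  have hrank : finrank ℝ (WithLp 2 (MomentModel.E p × W)) = finrank ℝ (MomentModel.E m) :=
    LinearEquiv.finrank_eq (LinearEquiv.ofBijective Q
      ⟨fun x y h => WithLp.ofLp_injective 2 (Prod.ext
        (by simpa [hA] using congrArg A h) (by simpa [hL] using congrArg L h)),
        fun z => ⟨_, hQ z⟩⟩)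
  have hadj : A.adjoint.normDet ^ 2 = (J * Jᵀ).det := by
    have hsq := A.adjoint.normDet_sq
    simp only [RCLike.ofReal_real_eq_id, id_eq, LinearMap.adjoint_adjoint] at hsq
    rw [hsq, ← Matrix.toEuclideanLin_conjTranspose_eq_adjoint,
      Matrix.conjTranspose_eq_transpose_of_trivial, ← Matrix.toLpLin_mul_same,
      Matrix.toLpLin_eq_toLin, LinearMap.det_toLin]
  have hG : G.normDet ^ 2 = (J * Jᵀ + 1).det := by
    have hsq := G.normDet_sq_eq_det_gram (EuclideanSpace.basisFun (Fin m) ℝ)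
    simp only [RCLike.ofReal_real_eq_id, id_eq] at hsq
    -- The Gram matrix of the graph map is `I + J'J`; Sylvester's identity exchanges it for `I +
    -- JJ'`.
    rw [hsq, add_comm, Matrix.det_one_add_mul_comm]
    congr 1
    ext i j
    have hGz : ∀ z, G z = WithLp.toLp 2 (A z, z) := fun _ => rfl
    rw [Matrix.gram_apply, hGz, hGz, WithLp.prod_inner_apply]
    simp [A, PiLp.inner_apply, Matrix.toLpLin_apply, Matrix.one_apply, Matrix.mul_apply,
      mul_comm, add_comm, eq_comm (a := i)]
  have hGne : G.normDet ≠ 0 := by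
    rw [Ne, LinearMap.normDet_eq_zero_iff_ker_ne_bot, not_not, LinearMap.ker_eq_bot']
    intro z hz
    exact congrArg WithLp.snd hz
  rw [LinearMap.normDet_restrict_snd_of_inverse hA hQ hN, hDG,
    LinearMap.normDet_comp_of_finrank_eq _ _ hrank, MomentModel.jacobianFactor, ← hadj, ← hG,
    Real.sqrt_sq A.adjoint.normDet_nonneg, Real.sqrt_sq G.normDet_nonneg]
  field_simp

end NormDet

/-! ### The moment map, implicit differentiation and measurability. -/

noncomputable section

theorem ContinuousOn.measurableSet_inter_preimage {α γ : Type*} [TopologicalSpace α]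
    [MeasurableSpace α] [OpensMeasurableSpace α] [TopologicalSpace γ] [MeasurableSpace γ]
    [BorelSpace γ] {f : α → γ} {s : Set α} {t : Set γ} (hf : ContinuousOn f s)
    (hs : MeasurableSet s) (ht : MeasurableSet t) : MeasurableSet (s ∩ f ⁻¹' t) := by
  have h := (MeasurableEmbedding.subtype_coe hs).measurableSet_image.2
    (hf.domRestrict.measurable ht)
  convert h using 1
  ext x
  simp [and_comm]

namespace MomentModel

open Module Set Filter

variable {d p m : ℕ}

/-- The linear map `θ ↦ H_β θ`, as a continuous linear map. -/
def slopeMap (g : E d → E p → E p) (s : Fin (m + 1) → E d) (β : E p) : E m →L[ℝ] E p :=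
  ∑ j : Fin m, ContinuousLinearMap.smulRightL ℝ (E m) (E p) (EuclideanSpace.proj j)
    (g (s j.castSucc) β - g (s (Fin.last m)) β)

theorem slopeMap_apply (g : E d → E p → E p) (s : Fin (m + 1) → E d) (β : E p) (θ : E m) :
    slopeMap g s β θ = ∑ j, θ j • (g (s j.castSucc) β - g (s (Fin.last m)) β) := by
  simp [slopeMap]

theorem ofLp_slopeMap (g : E d → E p → E p) (s : Fin (m + 1) → E d) (β : E p) (θ : E m) :
    (slopeMap g s β θ).ofLp = H g s β *ᵥ fun j => θ j := by
  ext i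
  simp [slopeMap_apply, H, Matrix.mulVec, dotProduct, mul_comm]

theorem momentCondition_iff_slopeMap (g : E d → E p → E p) (s : Fin (m + 1) → E d) (β : E p)
    (θ : E m) : MomentCondition g s β θ ↔ slopeMap g s β θ + g (s (Fin.last m)) β = 0 := by
  rw [MomentCondition, ← ofLp_slopeMap]
  exact ⟨fun h => PiLp.ext h, fun h i => congrArg (fun v : E p => v i) h⟩

theorem slopeMap_surjective {g : E d → E p → E p} {s : Fin (m + 1) → E d} {β : E p}
    (h : (H g s β).rank = p) : Function.Surjective (slopeMap g s β) := by
  have h1 : LinearMap.range (H g s β).mulVecLin = ⊤ :=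
    Submodule.eq_top_of_finrank_eq (by rw [← Matrix.rank, h]; simp)
  intro v
  obtain ⟨w, hw⟩ := LinearMap.range_eq_top.1 h1 v.ofLp
  refine ⟨WithLp.toLp 2 w, WithLp.ofLp_injective 2 ?_⟩
  rw [ofLp_slopeMap]
  exact hw

variable {g : E d → E p → E p} {s : Fin (m + 1) → E d} {β : E p}

theorem contDiffAt_slopeMap (hg : ∀ j, ContDiffAt ℝ 1 (g (s j)) β) :
    ContDiffAt ℝ 1 (slopeMap g s) β := by
  refine ContDiffAt.sum fun j _ => ?_
  exact (ContinuousLinearMap.contDiff _).contDiffAt.comp β ((hg _).sub (hg _))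

/-- The derivative of the moments `H_β θ + g_J` in `β`. -/
def momentDeriv (g : E d → E p → E p) (s : Fin (m + 1) → E d) (β : E p) (θ : E m) :
    E p →L[ℝ] E p :=
  (fderiv ℝ (slopeMap g s) β).flip θ + fderiv ℝ (g (s (Fin.last m))) β

/-- The chain rule for the moments along a differentiable curve of parameters. -/
theorem hasFDerivAt_moment {Y : Type*} [NormedAddCommGroup Y] [NormedSpace ℝ Y]
    (hg : ∀ j, ContDiffAt ℝ 1 (g (s j)) β) {θ : E m} {b : Y → E p} {c : Y → E m} {y : Y}
    {b' : Y →L[ℝ] E p} {c' : Y →L[ℝ] E m} (hb : HasFDerivAt b b' y) (hc : HasFDerivAt c c' y)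
    (hby : b y = β) (hcy : c y = θ) :
    HasFDerivAt (fun x => slopeMap g s (b x) (c x) + g (s (Fin.last m)) (b x))
      (momentDeriv g s β θ ∘L b' + slopeMap g s β ∘L c') y := by
  subst hby hcy
  have h1 := ((contDiffAt_slopeMap hg).differentiableAt one_ne_zero).hasFDerivAt.comp y hb
  have h2 := ((hg (Fin.last m)).differentiableAt one_ne_zero).hasFDerivAt.comp y hb
  refine ((h1.clm_apply hc).add h2).congr_fderiv ?_
  ext v : 1
  simp [momentDeriv]
  abel

/-- The implicit function identity `∂F/∂β · ∂β/∂θ' = - H_β`. -/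
theorem IsBetaJacobian.momentDeriv_apply (hg : ∀ j, ContDiffAt ℝ 1 (g (s j)) β) {θ : E m}
    {A : Matrix (Fin p) (Fin m) ℝ} (hA : IsBetaJacobian g s β θ A) (v : E m) :
    momentDeriv g s β θ (Matrix.toEuclideanLin A v) = -slopeMap g s β v := by
  obtain ⟨b, hb, hmom, hderiv⟩ := hA
  have h := hasFDerivAt_moment hg hderiv (hasFDerivAt_id θ) hb rfl
  have h0 : (fun x => slopeMap g s (b x) (id x) + g (s (Fin.last m)) (b x)) =ᶠ[𝓝 θ]
      fun _ => 0 := hmom.mono fun x hx => (momentCondition_iff_slopeMap g s _ _).1 hx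
  have h1 := congrArg (fun f : E m →L[ℝ] E p => f v)
    (h.unique ((hasFDerivAt_const (0 : E p) θ).congr_of_eventuallyEq h0))
  exact eq_neg_of_add_eq_zero_left (by simpa using h1)

/-- Nondegeneracy in `β` comes for free: `∂F/∂β · A = -H_β` and `H_β` is onto, so the square matrix
`∂F/∂β` is onto too. -/
theorem IsBetaJacobian.bijective_momentDeriv (hg : ∀ j, ContDiffAt ℝ 1 (g (s j)) β)
    (hH : (H g s β).rank = p) {θ : E m} {A : Matrix (Fin p) (Fin m) ℝ}
    (hA : IsBetaJacobian g s β θ A) : Function.Bijective (momentDeriv g s β θ) := by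
  have hsurj : Function.Surjective (momentDeriv g s β θ) := fun v => by
    obtain ⟨w, hw⟩ := slopeMap_surjective hH v
    refine ⟨-Matrix.toEuclideanLin A w, ?_⟩
    rw [map_neg, hA.momentDeriv_apply hg, neg_neg, hw]
  exact ⟨LinearMap.injective_iff_surjective (f := (momentDeriv g s β θ).toLinearMap) |>.2 hsurj,
    hsurj⟩

/-- The point `(β, θ)` alone determines the Jacobian, whatever the local solution `b`. -/
theorem IsBetaJacobian.eq_inverse (hg : ∀ j, ContDiffAt ℝ 1 (g (s j)) β)
    (hH : (H g s β).rank = p) {θ : E m} {A : Matrix (Fin p) (Fin m) ℝ}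
    (hA : IsBetaJacobian g s β θ A) : IsUnit (momentDeriv g s β θ) ∧ ∀ v,
      Matrix.toEuclideanLin A v = -Ring.inverse (momentDeriv g s β θ) (slopeMap g s β v) := by
  have hbij := hA.bijective_momentDeriv hg hH
  have hu : IsUnit (momentDeriv g s β θ) := ContinuousLinearMap.isUnit_iff_bijective.2 hbij
  refine ⟨hu, fun v => hbij.1 ?_⟩
  rw [hA.momentDeriv_apply hg, map_neg, ← mul_apply_eq_comp,
    Ring.mul_inverse_cancel _ hu, one_apply_eq_self]

theorem continuousAt_momentDeriv (hg : ∀ j, ContDiffAt ℝ 1 (g (s j)) β) (θ : E m) :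
    ContinuousAt (fun x : Joint p m => momentDeriv g s x.fst x.snd) (pair β θ) := by
  have hfst : ContinuousAt (fun x : Joint p m => x.fst) (pair β θ) :=
    (WithLp.prod_continuous_ofLp 2 _ _).fst.continuousAt
  have hsnd : ContinuousAt (fun x : Joint p m => x.snd) (pair β θ) :=
    (WithLp.prod_continuous_ofLp 2 _ _).snd.continuousAt
  have h1 : ContinuousAt (fderiv ℝ (slopeMap g s)) β :=
    (contDiffAt_slopeMap hg).continuousAt_fderiv one_ne_zero
  have h2 : ContinuousAt (fderiv ℝ (g (s (Fin.last m)))) β :=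
    (hg _).continuousAt_fderiv one_ne_zero
  have h3 : ContinuousAt (fun x : Joint p m => (fderiv ℝ (slopeMap g s) x.fst).flip)
      (pair β θ) :=
    (ContinuousLinearMap.flipₗᵢ ℝ (E p) (E m) (E p)).continuous.continuousAt.comp
      (ContinuousAt.comp (g := fderiv ℝ (slopeMap g s)) h1 hfst)
  exact (h3.clm_apply hsnd).add (ContinuousAt.comp (g := fderiv ℝ (g (s (Fin.last m)))) h2 hfst)

variable {Θβ : Set (E p)}

/-- `Jθ` is prescribed only pointwise; its regularity comes from the explicit formula `-(∂F/∂β)⁻¹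
H_β`. -/
theorem continuousOn_betaJacobian (hg : ∀ j, ∀ β ∈ Θβ, ContDiffAt ℝ 1 (g (s j)) β)
    (hH : ∀ β ∈ Θβ, (H g s β).rank = p) {Jθ : E p → E m → Matrix (Fin p) (Fin m) ℝ}
    (hJ : ∀ β θ, pair β θ ∈ paramSpace g s Θβ → IsBetaJacobian g s β θ (Jθ β θ)) :
    ContinuousOn (fun x : Joint p m => Jθ x.fst x.snd) (paramSpace g s Θβ) := by
  intro x hx
  refine continuousWithinAt_pi.2 fun i => continuousWithinAt_pi.2 fun j => ?_
  have hcont : ContinuousAt (fun y : Joint p m =>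
      (-Ring.inverse (momentDeriv g s y.fst y.snd)
        (slopeMap g s y.fst (EuclideanSpace.single j (1 : ℝ)))) i) x := by
    have hgx := fun j => hg j x.fst hx.1
    obtain ⟨hu, -⟩ := (hJ x.fst x.snd hx).eq_inverse hgx (hH _ hx.1)
    have h1 : ContinuousAt (fun y : Joint p m => Ring.inverse (momentDeriv g s y.fst y.snd)) x :=
      ContinuousAt.comp (x := x) (g := Ring.inverse)
        (f := fun y : Joint p m => momentDeriv g s y.fst y.snd)
        (NormedRing.inverse_continuousAt hu.unit) (continuousAt_momentDeriv hgx x.snd)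
    have h2 : ContinuousAt (fun y : Joint p m => slopeMap g s y.fst) x :=
      ContinuousAt.comp (g := slopeMap g s) (contDiffAt_slopeMap hgx).continuousAt
        (WithLp.prod_continuous_ofLp 2 _ _).fst.continuousAt
    have h3 := (h1.clm_apply (h2.clm_apply
      (continuousAt_const (y := EuclideanSpace.single j (1 : ℝ))))).neg
    exact (EuclideanSpace.proj (𝕜 := ℝ) i).continuous.continuousAt.comp h3
  refine hcont.continuousWithinAt.congr_of_eventuallyEq_of_mem ?_ hx
  filter_upwards [self_mem_nhdsWithin] with y hy
  rw [← ((hJ y.fst y.snd hy).eq_inverse (fun j => hg j y.fst hy.1) (hH _ hy.1)).2]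
  simp [Matrix.toLpLin_apply]

theorem measurableSet_paramSpace (hΘβ : MeasurableSet Θβ)
    (hg : ∀ j, ∀ β ∈ Θβ, ContDiffAt ℝ 1 (g (s j)) β) : MeasurableSet (paramSpace g s Θβ) := by
  have hfst : Continuous fun x : Joint p m => x.fst := (WithLp.prod_continuous_ofLp 2 _ _).fst
  have hsnd : Continuous fun x : Joint p m => x.snd := (WithLp.prod_continuous_ofLp 2 _ _).snd
  have hcont : ContinuousOn (fun x : Joint p m =>
      slopeMap g s x.fst x.snd + g (s (Fin.last m)) x.fst) {x | x.fst ∈ Θβ} := by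
    intro x hx
    have hgx := fun j => hg j x.fst hx
    have h1 : ContinuousAt (fun y : Joint p m => slopeMap g s y.fst) x :=
      ContinuousAt.comp (g := slopeMap g s) (contDiffAt_slopeMap hgx).continuousAt
        hfst.continuousAt
    have h2 : ContinuousAt (fun y : Joint p m => g (s (Fin.last m)) y.fst) x :=
      ContinuousAt.comp (g := g (s (Fin.last m))) (hgx _).continuousAt hfst.continuousAt
    exact ((h1.clm_apply hsnd.continuousAt).add h2).continuousWithinAt
  have hsimplex : MeasurableSet (simplex m) := by
    have h : IsOpen (simplex m) := by
      have hrw : simplex m = (⋂ j, {θ : E m | 0 < θ j}) ∩ {θ : E m | ∑ j, θ j < 1} := by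
        ext θ
        simp [simplex]
      rw [hrw]
      exact (isOpen_iInter_of_finite fun j => isOpen_lt (by fun_prop) (by fun_prop)).inter
        (isOpen_lt (by fun_prop) (by fun_prop))
    exact h.measurableSet
  have hmoment := hcont.measurableSet_inter_preimage (hfst.measurable hΘβ)
    (measurableSet_singleton 0)
  convert hmoment.inter (hsnd.measurable hsimplex) using 1
  ext x
  simp only [paramSpace, momentCondition_iff_slopeMap, mem_ofPred_eq, mem_inter_iff, mem_preimage,
    mem_singleton_iff]
  tauto

/-- `Jθ` is arbitrary off the parameter space, hence the restricted measure. -/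
theorem aemeasurable_jointDensity (hΘβ : MeasurableSet Θβ)
    (hg : ∀ j, ∀ β ∈ Θβ, ContDiffAt ℝ 1 (g (s j)) β)
    (hH : ∀ β ∈ Θβ, (H g s β).rank = p) {Jθ : E p → E m → Matrix (Fin p) (Fin m) ℝ}
    (hJ : ∀ β θ, pair β θ ∈ paramSpace g s Θβ → IsBetaJacobian g s β θ (Jθ β θ))
    {pβ : E p → ℝ≥0∞} (hpβ : Measurable pβ) {pcond : E p → E m → ℝ≥0∞}
    (hpcond : Measurable (Function.uncurry pcond)) (μ : Measure (Joint p m)) :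
    AEMeasurable (jointDensity Jθ pβ pcond) (μ.restrict (paramSpace g s Θβ)) := by
  have hS := measurableSet_paramSpace (s := s) hΘβ hg
  have hJc := continuousOn_betaJacobian hg hH hJ
  have hJJ : ContinuousOn (fun x : Joint p m => Jθ x.fst x.snd * (Jθ x.fst x.snd)ᵀ)
      (paramSpace g s Θβ) :=
    (Continuous.matrix_mul continuous_id continuous_id.matrix_transpose).comp_continuousOn hJc
  have h1 := (Real.continuous_sqrt.comp_continuousOn
    ((continuous_id.matrix_det).comp_continuousOn hJJ)).aemeasurable hS (μ := μ)
  have h2 := (Real.continuous_sqrt.comp_continuousOn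
    ((continuous_id.matrix_det).comp_continuousOn
      (hJJ.add (continuousOn_const (c := 1))))).aemeasurable hS (μ := μ)
  have hofLp : Measurable (fun x : Joint p m => (x.fst, x.snd)) :=
    (WithLp.prod_continuous_ofLp 2 _ _).measurable
  exact (h1.div h2).ennreal_ofReal.mul
    ((hpβ.comp hofLp.fst).mul (hpcond.comp hofLp)).aemeasurable

end MomentModel
end

/-! ### Local charts of the slices and of the parameter space. -/

noncomputable section

namespace MomentModel

open Module Set Filter

variable {d p m : ℕ} {W : Type*} [NormedAddCommGroup W] [InnerProductSpace ℝ W]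

/-- In the coordinates `T`, the map `θ ↦ (H_β θ, t)` where `t` is the second coordinate of `θ`. -/
def frame (g : E d → E p → E p) (s : Fin (m + 1) → E d) (T : WithLp 2 (E p × W) ≃L[ℝ] E m)
    (β : E p) : E m →L[ℝ] E m :=
  T.toContinuousLinearMap ∘L (WithLp.prodContinuousLinearEquiv 2 ℝ (E p) W).symm ∘L
    (slopeMap g s β).prod (WithLp.sndL 2 ℝ (E p) W ∘L T.symm.toContinuousLinearMap)

/-- The solution `θ` of the moment conditions at `y.fst` whose second coordinate is `y.snd`. -/
def chart (g : E d → E p → E p) (s : Fin (m + 1) → E d) (T : WithLp 2 (E p × W) ≃L[ℝ] E m)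
    (y : WithLp 2 (E p × W)) : E m :=
  Ring.inverse (frame g s T y.fst) (T (WithLp.toLp 2 (-g (s (Fin.last m)) y.fst, y.snd)))

/-- The linear part of `t ↦ chart g s T (β, t)`. -/
def chartSlice (g : E d → E p → E p) (s : Fin (m + 1) → E d) (T : WithLp 2 (E p × W) ≃L[ℝ] E m)
    (β : E p) : W →L[ℝ] E m :=
  Ring.inverse (frame g s T β) ∘L T.toContinuousLinearMap ∘L
    (WithLp.prodContinuousLinearEquiv 2 ℝ (E p) W).symm.toContinuousLinearMap ∘L
      ContinuousLinearMap.inr ℝ (E p) W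

variable {g : E d → E p → E p} {s : Fin (m + 1) → E d} {T : WithLp 2 (E p × W) ≃L[ℝ] E m}

theorem frame_apply (β : E p) (θ : E m) :
    frame g s T β θ = T (WithLp.toLp 2 (slopeMap g s β θ, (T.symm θ).snd)) := rfl

/-- The chart solves the frame equation. `Ring.inverse` is zero off the units, hence the hypothesis
`hu`. -/
theorem slopeMap_chart {y : WithLp 2 (E p × W)} (hu : IsUnit (frame g s T y.fst)) :
    slopeMap g s y.fst (chart g s T y) = -g (s (Fin.last m)) y.fst ∧
      (T.symm (chart g s T y)).snd = y.snd := by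
  have h : frame g s T y.fst (chart g s T y) =
      T (WithLp.toLp 2 (-g (s (Fin.last m)) y.fst, y.snd)) := by
    rw [chart, ← mul_apply_eq_comp, Ring.mul_inverse_cancel _ hu, one_apply_eq_self]
  rw [frame_apply] at h
  have h₁ := congrArg WithLp.fst (T.injective h)
  have h₂ := congrArg WithLp.snd (T.injective h)
  exact ⟨h₁, h₂⟩

/-- With `slopeMap_chart`, this makes `t ↦ chart g s T (β, t)` a bijection from `W` onto the slice
at `β`. -/
theorem chart_eq {β : E p} (hu : IsUnit (frame g s T β)) {θ : E m}
    (h : slopeMap g s β θ + g (s (Fin.last m)) β = 0) :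
    chart g s T (WithLp.toLp 2 (β, (T.symm θ).snd)) = θ := by
  change Ring.inverse (frame g s T β)
    (T (WithLp.toLp 2 (-g (s (Fin.last m)) β, (T.symm θ).snd))) = θ
  rw [← eq_neg_of_add_eq_zero_left h, ← frame_apply, ← mul_apply_eq_comp,
    Ring.inverse_mul_cancel _ hu, one_apply_eq_self]

/-- For fixed `β` the chart is affine in `t`, even where `Ring.inverse` takes its default value. -/
theorem hasFDerivAt_chart_slice (β : E p) (t : W) :
    HasFDerivAt (fun t => chart g s T (WithLp.toLp 2 (β, t))) (chartSlice g s T β) t := by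
  have h : (fun t => chart g s T (WithLp.toLp 2 (β, t))) = fun t =>
      chartSlice g s T β t + chart g s T (WithLp.toLp 2 (β, 0)) := by
    ext1 t
    change Ring.inverse (frame g s T β) (T (WithLp.toLp 2 (-g (s (Fin.last m)) β, t))) =
      Ring.inverse (frame g s T β) (T (WithLp.toLp 2 (0, t))) +
        Ring.inverse (frame g s T β) (T (WithLp.toLp 2 (-g (s (Fin.last m)) β, 0)))
    rw [← map_add, ← map_add, ← WithLp.toLp_add]
    simp
  rw [h]
  exact (chartSlice g s T β).hasFDerivAt.add_const _

theorem contDiffAt_frame {β : E p} (hg : ∀ j, ContDiffAt ℝ 1 (g (s j)) β) :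
    ContDiffAt ℝ 1 (frame g s T) β := by
  have h1 : ContDiffAt ℝ 1 (fun β => (slopeMap g s β).prod
      (WithLp.sndL 2 ℝ (E p) W ∘L T.symm.toContinuousLinearMap)) β := by
    have hprod : (fun β => (slopeMap g s β).prod
        (WithLp.sndL 2 ℝ (E p) W ∘L T.symm.toContinuousLinearMap)) = fun β =>
        ContinuousLinearMap.inl ℝ (E p) W ∘L slopeMap g s β + ContinuousLinearMap.inr ℝ (E p) W ∘L
          (WithLp.sndL 2 ℝ (E p) W ∘L T.symm.toContinuousLinearMap) := by
      ext β v <;> simp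
    rw [hprod]
    exact (contDiffAt_const.clm_comp (contDiffAt_slopeMap hg)).add contDiffAt_const
  exact contDiffAt_const.clm_comp (contDiffAt_const.clm_comp h1)

theorem differentiableAt_chart {y : WithLp 2 (E p × W)}
    (hg : ∀ j, ContDiffAt ℝ 1 (g (s j)) y.fst) (hu : IsUnit (frame g s T y.fst)) :
    DifferentiableAt ℝ (chart g s T) y := by
  have hfst : DifferentiableAt ℝ (fun y : WithLp 2 (E p × W) => y.fst) y :=
    (WithLp.fstL 2 ℝ (E p) W).differentiableAt
  have hsnd : DifferentiableAt ℝ (fun y : WithLp 2 (E p × W) => y.snd) y :=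
    (WithLp.sndL 2 ℝ (E p) W).differentiableAt
  have h1 : DifferentiableAt ℝ (fun y : WithLp 2 (E p × W) => Ring.inverse (frame g s T y.fst)) y :=
    DifferentiableAt.comp (g := Ring.inverse) (f := fun y : WithLp 2 (E p × W) =>
      frame g s T y.fst) y (hasFDerivAt_ringInverse (𝕜 := ℝ) hu.unit).differentiableAt
      (DifferentiableAt.comp (g := frame g s T) y
        ((contDiffAt_frame hg).differentiableAt one_ne_zero) hfst)
  have h2 : DifferentiableAt ℝ (fun y : WithLp 2 (E p × W) => g (s (Fin.last m)) y.fst) y :=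
    DifferentiableAt.comp (g := g (s (Fin.last m))) y
      ((hg _).differentiableAt one_ne_zero) hfst
  have h3 : DifferentiableAt ℝ (fun y : WithLp 2 (E p × W) =>
      T (WithLp.toLp 2 (-g (s (Fin.last m)) y.fst, y.snd))) y :=
    T.differentiableAt.comp y
      ((WithLp.prodContinuousLinearEquiv 2 ℝ (E p) W).symm.differentiableAt.comp y
        (h2.neg.prodMk hsnd))
  exact h1.clm_apply h3

theorem continuousOn_chartSlice {S : Set (E p)} (hg : ∀ j, ∀ β ∈ S, ContDiffAt ℝ 1 (g (s j)) β)
    (hu : ∀ β ∈ S, IsUnit (frame g s T β)) : ContinuousOn (chartSlice g s T) S := by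
  intro β hβ
  have h1 : ContinuousAt (fun β => Ring.inverse (frame g s T β)) β :=
    ContinuousAt.comp (g := Ring.inverse) (NormedRing.inverse_continuousAt (hu β hβ).unit)
      (contDiffAt_frame fun j => hg j β hβ).continuousAt
  exact (h1.clm_comp continuousAt_const).continuousWithinAt

/-- The differentiated moment conditions along the chart. -/
theorem fderiv_chart {y : WithLp 2 (E p × W)} (hg : ∀ j, ContDiffAt ℝ 1 (g (s j)) y.fst)
    (hu : IsUnit (frame g s T y.fst)) {A : Matrix (Fin p) (Fin m) ℝ}
    (hH : (H g s y.fst).rank = p) (hA : IsBetaJacobian g s y.fst (chart g s T y) A)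
    (v : WithLp 2 (E p × W)) :
    Matrix.toEuclideanLin A (fderiv ℝ (chart g s T) y v) = v.fst ∧
      (T.symm (fderiv ℝ (chart g s T) y v)).snd = v.snd := by
  have hd := (differentiableAt_chart hg hu).hasFDerivAt
  -- Units are open, so the defining equations of the chart hold near `y` and can be differentiated.
  have hev : ∀ᶠ z in 𝓝 y, IsUnit (frame g s T z.fst) :=
    (ContinuousAt.comp (g := frame g s T) (contDiffAt_frame hg).continuousAt
      (WithLp.fstL 2 ℝ (E p) W).continuous.continuousAt).eventually (Units.isOpen.mem_nhds hu)
  constructor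
  · have h := hasFDerivAt_moment hg (WithLp.fstL 2 ℝ (E p) W).hasFDerivAt hd rfl rfl
    have h0 : (fun x => slopeMap g s (WithLp.fstL 2 ℝ (E p) W x) (chart g s T x) +
        g (s (Fin.last m)) (WithLp.fstL 2 ℝ (E p) W x)) =ᶠ[𝓝 y] fun _ => 0 :=
      hev.mono fun z hz => add_eq_zero_iff_eq_neg.2 (slopeMap_chart hz).1
    have h1 := congrArg (fun f : WithLp 2 (E p × W) →L[ℝ] E p => f v)
      (h.unique ((hasFDerivAt_const (0 : E p) y).congr_of_eventuallyEq h0))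
    -- Differentiation gives `∂F/∂β · v.fst = -H_β (dθ v)`, and the right side is `∂F/∂β · A (dθ
    -- v)`; now cancel `∂F/∂β`.
    refine (hA.bijective_momentDeriv hg hH).1 ?_
    rw [hA.momentDeriv_apply hg]
    exact (eq_neg_of_add_eq_zero_left h1).symm
  · have h := (WithLp.sndL 2 ℝ (E p) W ∘L T.symm.toContinuousLinearMap).hasFDerivAt.comp y hd
    have h0 : (WithLp.sndL 2 ℝ (E p) W ∘L T.symm.toContinuousLinearMap) ∘ chart g s T =ᶠ[𝓝 y]
        WithLp.sndL 2 ℝ (E p) W := hev.mono fun z hz => (slopeMap_chart hz).2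
    exact congrArg (fun f : WithLp 2 (E p × W) →L[ℝ] W => f v)
      (h.unique ((WithLp.sndL 2 ℝ (E p) W).hasFDerivAt.congr_of_eventuallyEq h0))

/-- The chart `(β, t) ↦ (β, θ)` of the parameter space. -/
def jointChart (g : E d → E p → E p) (s : Fin (m + 1) → E d) (T : WithLp 2 (E p × W) ≃L[ℝ] E m)
    (y : WithLp 2 (E p × W)) : Joint p m := pair y.fst (chart g s T y)

/-- The derivative of `jointChart`. -/
def jointChartDeriv (g : E d → E p → E p) (s : Fin (m + 1) → E d)
    (T : WithLp 2 (E p × W) ≃L[ℝ] E m) (y : WithLp 2 (E p × W)) :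
    WithLp 2 (E p × W) →L[ℝ] Joint p m :=
  (WithLp.prodContinuousLinearEquiv 2 ℝ (E p) (E m)).symm.toContinuousLinearMap ∘L
    (WithLp.fstL 2 ℝ (E p) W).prod (fderiv ℝ (chart g s T) y)

theorem hasFDerivAt_jointChart {y : WithLp 2 (E p × W)}
    (hg : ∀ j, ContDiffAt ℝ 1 (g (s j)) y.fst) (hu : IsUnit (frame g s T y.fst)) :
    HasFDerivAt (jointChart g s T) (jointChartDeriv g s T y) y :=
  (WithLp.prodContinuousLinearEquiv 2 ℝ (E p) (E m)).symm.hasFDerivAt.comp y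
    ((WithLp.fstL 2 ℝ (E p) W).hasFDerivAt.prodMk (differentiableAt_chart hg hu).hasFDerivAt)

theorem fderiv_chart_injective {y : WithLp 2 (E p × W)}
    (hg : ∀ j, ContDiffAt ℝ 1 (g (s j)) y.fst)
    (hu : IsUnit (frame g s T y.fst)) {A : Matrix (Fin p) (Fin m) ℝ}
    (hH : (H g s y.fst).rank = p) (hA : IsBetaJacobian g s y.fst (chart g s T y) A) :
    Function.Injective (fderiv ℝ (chart g s T) y) := by
  intro v w h
  have hv := fderiv_chart hg hu hH hA v
  have hw := fderiv_chart hg hu hH hA w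
  rw [h] at hv
  exact WithLp.ofLp_injective 2 (Prod.ext (hv.1.symm.trans hw.1) (hv.2.symm.trans hw.2))

theorem jointChartDeriv_injective {y : WithLp 2 (E p × W)}
    (hg : ∀ j, ContDiffAt ℝ 1 (g (s j)) y.fst)
    (hu : IsUnit (frame g s T y.fst)) {A : Matrix (Fin p) (Fin m) ℝ}
    (hH : (H g s y.fst).rank = p) (hA : IsBetaJacobian g s y.fst (chart g s T y) A) :
    Function.Injective (jointChartDeriv g s T y) := fun _ _ h =>
  fderiv_chart_injective hg hu hH hA (congrArg WithLp.snd h)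

/-- The factor in the density is exactly what converts the volume of the joint chart into that of
the slice chart. -/
theorem normDet_jointChartDeriv [FiniteDimensional ℝ W] {y : WithLp 2 (E p × W)}
    (hg : ∀ j, ContDiffAt ℝ 1 (g (s j)) y.fst)
    (hu : IsUnit (frame g s T y.fst)) {A : Matrix (Fin p) (Fin m) ℝ}
    (hH : (H g s y.fst).rank = p) (hA : IsBetaJacobian g s y.fst (chart g s T y) A) :
    (jointChartDeriv g s T y).toLinearMap.normDet * jacobianFactor A =
      (chartSlice g s T y.fst).toLinearMap.normDet := by
  have hinj := fderiv_chart_injective hg hu hH hA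
  have hsurj : Function.Surjective (fderiv ℝ (chart g s T) y) :=
    (LinearMap.injective_iff_surjective_of_finrank_eq_finrank
      (f := (fderiv ℝ (chart g s T) y).toLinearMap) T.toLinearEquiv.finrank_eq).1 hinj
  have hspec := fderiv_chart hg hu hH hA
  refine normDet_mul_jacobianFactor
    (L := (WithLp.sndL 2 ℝ (E p) W ∘L T.symm.toContinuousLinearMap).toLinearMap)
    (Q := (fderiv ℝ (chart g s T) y).toLinearMap) (fun v => (hspec v).1) (fun v => (hspec v).2)
    (fun z => ?_) (fun t => ?_) (fun v => rfl)
  · obtain ⟨v, rfl⟩ := hsurj z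
    refine congrArg (fderiv ℝ (chart g s T) y) (WithLp.ofLp_injective 2 (Prod.ext ?_ ?_))
    · exact (hspec v).1
    · exact (hspec v).2
  -- The slice derivative, known from the affine formula, is also given by the chain rule;
  -- derivatives are unique.
  · have hd := (differentiableAt_chart hg hu).hasFDerivAt
    have hmk : HasFDerivAt (fun t : W => (WithLp.toLp 2 (y.fst, t) : WithLp 2 (E p × W)))
        ((WithLp.prodContinuousLinearEquiv 2 ℝ (E p) W).symm.toContinuousLinearMap ∘L
          ContinuousLinearMap.inr ℝ (E p) W) y.snd :=
      (WithLp.prodContinuousLinearEquiv 2 ℝ (E p) W).symm.hasFDerivAt.comp y.snd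
        (hasFDerivAt_prodMk_right y.fst y.snd)
    have h := HasFDerivAt.comp (g := chart g s T) y.snd hd hmk
    exact congrArg (fun f : W →L[ℝ] E m => f t)
      ((hasFDerivAt_chart_slice (g := g) (s := s) (T := T) y.fst y.snd).unique h)

theorem chartSlice_injective {β : E p} (hu : IsUnit (frame g s T β)) :
    Function.Injective (chartSlice g s T β) := by
  intro t t' h
  have h1 := congrArg (frame g s T β) h
  have h2 : ∀ t, frame g s T β (chartSlice g s T β t) = T (WithLp.toLp 2 (0, t)) := fun t => by
    change frame g s T β (Ring.inverse (frame g s T β) (T (WithLp.toLp 2 (0, t)))) = _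
    rw [← mul_apply_eq_comp, Ring.mul_inverse_cancel _ hu, one_apply_eq_self]
  rw [h2, h2] at h1
  exact congrArg WithLp.snd (T.injective h1)

end MomentModel
end

/-! ### Both sides of the density formula, computed in one chart. -/

noncomputable section

namespace MomentModel

open Module Set Filter

variable {d p m : ℕ} {W : Type*} [NormedAddCommGroup W] [InnerProductSpace ℝ W]
  {g : E d → E p → E p} {s : Fin (m + 1) → E d} {T : WithLp 2 (E p × W) ≃L[ℝ] E m}
  {Θβ S : Set (E p)} {A : Set (Joint p m)}

theorem measurable_pair : Measurable fun z : E p × E m => pair z.1 z.2 :=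
  (WithLp.prod_continuous_toLp 2 _ _).measurable

theorem continuousOn_chart (hg : ∀ j, ∀ β ∈ S, ContDiffAt ℝ 1 (g (s j)) β)
    (hu : ∀ β ∈ S, IsUnit (frame g s T β)) :
    ContinuousOn (chart g s T) {y : WithLp 2 (E p × W) | y.fst ∈ S} := fun y hy =>
  (differentiableAt_chart (fun j => hg j y.fst hy) (hu _ hy)).continuousAt.continuousWithinAt

variable [FiniteDimensional ℝ W] [MeasurableSpace W] [BorelSpace W]

/-- The conditional density integrates over a slice through the chart. -/
theorem withDensity_slice_apply {β : E p} (hu : IsUnit (frame g s T β)) {f : E m → ℝ≥0∞}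
    (hA : MeasurableSet A) (hAΘ : A ⊆ paramSpace g s Θβ) :
    ((μHE[m - p].restrict (slice g s β)).withDensity f) {θ | pair β θ ∈ A} =
      ∫⁻ t in {t : W | jointChart g s T (WithLp.toLp 2 (β, t)) ∈ A},
        ENNReal.ofReal (chartSlice g s T β).toLinearMap.normDet *
          f (chart g s T (WithLp.toLp 2 (β, t))) := by
  have hAβ : MeasurableSet {θ : E m | pair β θ ∈ A} :=
    (measurable_pair.comp measurable_prodMk_left) hA
  have hcont : Continuous fun t : W => chart g s T (WithLp.toLp 2 (β, t)) :=
    continuous_iff_continuousAt.2 fun t => (hasFDerivAt_chart_slice β t).continuousAt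
  have hrank : finrank ℝ W = m - p := by
    -- `T` gives `p + dim W = m`, so the truncated subtraction `m - p` is a true one.
    have h := T.toLinearEquiv.finrank_eq
    rw [(WithLp.linearEquiv 2 ℝ (E p × W)).finrank_eq, Module.finrank_prod,
      finrank_euclideanSpace_fin, finrank_euclideanSpace_fin] at h
    omega
  have hsub : {θ : E m | pair β θ ∈ A} ∩ slice g s β = {θ : E m | pair β θ ∈ A} :=
    inter_eq_left.2 fun θ hθ => (hAΘ hθ).2.2
  have himage : {θ : E m | pair β θ ∈ A} = (fun t : W => chart g s T (WithLp.toLp 2 (β, t))) ''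
      {t : W | jointChart g s T (WithLp.toLp 2 (β, t)) ∈ A} := by
    ext θ
    constructor
    · intro hθ
      have hθ' := chart_eq hu ((momentCondition_iff_slopeMap g s β θ).1 (hAΘ hθ).2.2)
      refine ⟨(T.symm θ).snd, ?_, hθ'⟩
      change pair β (chart g s T (WithLp.toLp 2 (β, (T.symm θ).snd))) ∈ A
      rwa [hθ']
    · rintro ⟨t, ht, rfl⟩
      exact ht
  rw [withDensity_apply _ hAβ, Measure.restrict_restrict hAβ, hsub, himage, ← hrank]
  refine lintegral_image_eq_lintegral_normDet_fderiv_mul (hcont.measurable hAβ)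
    (fun t _ => (hasFDerivAt_chart_slice β t).hasFDerivWithinAt) (fun t _ t' _ h => ?_)
    (fun _ _ => chartSlice_injective hu) f
  have h1 := (slopeMap_chart (y := WithLp.toLp 2 (β, t)) hu).2
  have h2 := (slopeMap_chart (y := WithLp.toLp 2 (β, t')) hu).2
  exact h1.symm.trans ((congrArg (fun θ => (T.symm θ).snd) h).trans h2)

theorem measurableSet_preimage_jointChart (hS : MeasurableSet S)
    (hg : ∀ j, ∀ β ∈ S, ContDiffAt ℝ 1 (g (s j)) β) (hu : ∀ β ∈ S, IsUnit (frame g s T β))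
    (hA : MeasurableSet A) (hAS : ∀ x ∈ A, x.fst ∈ S) :
    MeasurableSet (jointChart g s T ⁻¹' A) := by
  have hcont : ContinuousOn (jointChart g s T) {y : WithLp 2 (E p × W) | y.fst ∈ S} :=
    (WithLp.prod_continuous_toLp 2 (E p) (E m)).comp_continuousOn
      ((WithLp.prod_continuous_ofLp 2 (E p) W).fst.continuousOn.prodMk (continuousOn_chart hg hu))
  have h := hcont.measurableSet_inter_preimage
    ((WithLp.prod_continuous_ofLp 2 (E p) W).fst.measurable hS) hA
  -- `A` lies over `S`, so its preimage avoids the points where the frame is singular and the chart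
  -- is a default value.
  have hsub : jointChart g s T ⁻¹' A ⊆ {y | y.fst ∈ S} := fun y hy => hAS _ hy
  rwa [inter_eq_right.2 hsub] at h

/-- The integral of the joint density in the chart. -/
theorem lintegral_jointDensity_eq (hS : MeasurableSet S) (hSΘ : S ⊆ Θβ)
    (hg : ∀ j, ∀ β ∈ Θβ, ContDiffAt ℝ 1 (g (s j)) β)
    (hH : ∀ β ∈ Θβ, (H g s β).rank = p) {Jθ : E p → E m → Matrix (Fin p) (Fin m) ℝ}
    (hJ : ∀ β θ, pair β θ ∈ paramSpace g s Θβ → IsBetaJacobian g s β θ (Jθ β θ))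
    (hu : ∀ β ∈ S, IsUnit (frame g s T β)) (hA : MeasurableSet A)
    (hAΘ : A ⊆ paramSpace g s Θβ) (hAS : ∀ x ∈ A, x.fst ∈ S)
    (pβ : E p → ℝ≥0∞) (pcond : E p → E m → ℝ≥0∞) :
    ∫⁻ x in A, jointDensity Jθ pβ pcond x ∂μHE[m] =
      ∫⁻ y in jointChart g s T ⁻¹' A,
        ENNReal.ofReal (chartSlice g s T y.fst).toLinearMap.normDet *
          (pβ y.fst * pcond y.fst (chart g s T y)) := by
  have hmeas := measurableSet_preimage_jointChart hS (fun j β hβ => hg j β (hSΘ hβ)) hu hA hAS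
  have hrank : finrank ℝ (WithLp 2 (E p × W)) = m := by
    rw [T.toLinearEquiv.finrank_eq, finrank_euclideanSpace_fin]
  have himage : A = jointChart g s T '' (jointChart g s T ⁻¹' A) := by
    refine (image_preimage_eq_of_subset fun x hx => ?_).symm
    have h := chart_eq (hu _ (hAS x hx))
      ((momentCondition_iff_slopeMap g s x.fst x.snd).1 (hAΘ hx).2.2)
    exact ⟨WithLp.toLp 2 (x.fst, (T.symm x.snd).snd), congrArg (pair x.fst) h⟩
  have hS' : ∀ y ∈ jointChart g s T ⁻¹' A, y.fst ∈ S := fun y hy => hAS _ hy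
  have hg' : ∀ y ∈ jointChart g s T ⁻¹' A, ∀ j, ContDiffAt ℝ 1 (g (s j)) y.fst :=
    fun y hy j => hg j _ (hSΘ (hS' y hy))
  have hH' : ∀ y ∈ jointChart g s T ⁻¹' A, (H g s y.fst).rank = p :=
    fun y hy => hH _ (hSΘ (hS' y hy))
  have hJ' : ∀ y ∈ jointChart g s T ⁻¹' A,
      IsBetaJacobian g s y.fst (chart g s T y) (Jθ y.fst (chart g s T y)) :=
    fun y hy => hJ _ _ (hAΘ hy)
  have hinj : InjOn (jointChart g s T) (jointChart g s T ⁻¹' A) := fun y hy z hz h => by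
    have h1 := (slopeMap_chart (hu _ (hS' y hy))).2
    have h2 := (slopeMap_chart (hu _ (hS' z hz))).2
    have hfst := congrArg WithLp.fst h
    have hsnd := congrArg WithLp.snd h
    refine WithLp.ofLp_injective 2 (Prod.ext hfst ?_)
    exact h1.symm.trans ((congrArg (fun θ => (T.symm θ).snd) hsnd).trans h2)
  have harea := lintegral_image_eq_lintegral_normDet_fderiv_mul hmeas
    (fun y hy => (hasFDerivAt_jointChart (hg' y hy) (hu _ (hS' y hy))).hasFDerivWithinAt) hinj
    (fun y hy => jointChartDeriv_injective (hg' y hy) (hu _ (hS' y hy)) (hH' y hy) (hJ' y hy))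
    (jointDensity Jθ pβ pcond)
  rw [hrank, ← himage] at harea
  rw [harea]
  refine setLIntegral_congr_fun hmeas fun y hy => ?_
  change _ * (_ * _) = _
  rw [← mul_assoc, ← ENNReal.ofReal_mul (LinearMap.normDet_nonneg _)]
  exact congrArg (fun r => ENNReal.ofReal r * _)
    (normDet_jointChartDeriv (hg' y hy) (hu _ (hS' y hy)) (hH' y hy) (hJ' y hy))

/-- Disintegration of the joint law. -/
theorem map_pair_apply {Ω : Type*} [MeasurableSpace Ω] {P : Measure Ω} [IsProbabilityMeasure P]
    {B : Ω → E p} (hB : Measurable B) {T : Ω → E m} (hT : Measurable T) {pβ : E p → ℝ≥0∞}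
    (hpβ : Measurable pβ) (hBdens : P.map B = volume.withDensity pβ) (hA : MeasurableSet A) :
    (P.map fun ω => pair (B ω) (T ω)) A =
      ∫⁻ β, pβ β * condDistrib T B P β {θ | pair β θ ∈ A} := by
  have hmap : (P.map fun ω => pair (B ω) (T ω)) =
      (P.map fun ω => (B ω, T ω)).map fun z => pair z.1 z.2 :=
    (Measure.map_map measurable_pair (hB.prodMk hT)).symm
  have hA' := measurable_pair hA
  rw [hmap, Measure.map_apply measurable_pair hA, ← compProd_map_condDistrib hT.aemeasurable,
    Measure.compProd_apply hA', hBdens,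
    lintegral_withDensity_eq_lintegral_mul _ hpβ (Kernel.measurable_kernel_prodMk_left hA')]
  rfl

/-- The joint law on the part of the parameter space covered by a chart. -/
theorem map_pair_apply_eq_lintegral_jointDensity {Ω : Type*} [MeasurableSpace Ω] {P : Measure Ω}
    [IsProbabilityMeasure P] {B : Ω → E p} (hB : Measurable B) {τ : Ω → E m} (hτ : Measurable τ)
    {pβ : E p → ℝ≥0∞} (hpβ : Measurable pβ) (hBdens : P.map B = volume.withDensity pβ)
    {pcond : E p → E m → ℝ≥0∞} (hpcond : Measurable (Function.uncurry pcond))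
    (hTdens : ∀ᵐ β ∂(P.map B), β ∈ Θβ →
      condDistrib τ B P β = (μHE[m - p].restrict (slice g s β)).withDensity (pcond β))
    (hS : MeasurableSet S) (hSΘ : S ⊆ Θβ)
    (hg : ∀ j, ∀ β ∈ Θβ, ContDiffAt ℝ 1 (g (s j)) β)
    (hH : ∀ β ∈ Θβ, (H g s β).rank = p) {Jθ : E p → E m → Matrix (Fin p) (Fin m) ℝ}
    (hJ : ∀ β θ, pair β θ ∈ paramSpace g s Θβ → IsBetaJacobian g s β θ (Jθ β θ))
    (hu : ∀ β ∈ S, IsUnit (frame g s T β)) (hA : MeasurableSet A)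
    (hAΘ : A ⊆ paramSpace g s Θβ) (hAS : ∀ x ∈ A, x.fst ∈ S) :
    (P.map fun ω => pair (B ω) (τ ω)) A = ∫⁻ x in A, jointDensity Jθ pβ pcond x ∂μHE[m] := by
  set D := jointChart g s T ⁻¹' A
  have hgS : ∀ j, ∀ β ∈ S, ContDiffAt ℝ 1 (g (s j)) β := fun j β hβ => hg j β (hSΘ hβ)
  have hD : MeasurableSet D := measurableSet_preimage_jointChart hS hgS hu hA hAS
  set I : WithLp 2 (E p × W) → ℝ≥0∞ := fun y =>
    ENNReal.ofReal (chartSlice g s T y.fst).toLinearMap.normDet *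
      (pβ y.fst * pcond y.fst (chart g s T y))
  have hfst : Continuous fun y : WithLp 2 (E p × W) => y.fst :=
    (WithLp.prod_continuous_ofLp 2 _ _).fst
  have hDS : D ⊆ {y | y.fst ∈ S} := fun y hy => hAS _ hy
  have hImeas : AEMeasurable I (volume.restrict D) := by
    have h1 : AEMeasurable (chart g s T) (volume.restrict D) :=
      ((continuousOn_chart hgS hu).mono hDS).aemeasurable hD
    have h2 : ContinuousOn (fun y : WithLp 2 (E p × W) => chartSlice g s T y.fst) D :=
      (continuousOn_chartSlice hgS hu).comp hfst.continuousOn hDS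
    have h3 := (ContinuousLinearMap.continuous_normDet.comp_continuousOn h2).aemeasurable hD
      (μ := volume)
    exact h3.ennreal_ofReal.mul ((hpβ.comp hfst.measurable).aemeasurable.mul
      (hpcond.comp_aemeasurable (hfst.measurable.aemeasurable.prodMk h1)))
  have hImeas' : AEMeasurable (D.indicator I) volume := (aemeasurable_indicator_iff hD).2 hImeas
  -- The Euclidean volume on the chart domain is the product of Lebesgue measures, so Tonelli
  -- separates `β` from `t`.
  have hpres : MeasurePreserving (MeasurableEquiv.toLp 2 (E p × W)) volume volume :=
    WithLp.volume_preserving_toLp _ _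
  have hfubini : ∫⁻ y in D, I y =
      ∫⁻ β, ∫⁻ t, D.indicator I (MeasurableEquiv.toLp 2 (E p × W) (β, t)) := by
    rw [← lintegral_indicator hD,
      ← hpres.lintegral_comp_emb (MeasurableEquiv.measurableEmbedding _), Measure.volume_eq_prod]
    exact lintegral_prod _ (hImeas'.comp_quasiMeasurePreserving hpres.quasiMeasurePreserving)
  rw [lintegral_jointDensity_eq hS hSΘ hg hH hJ hu hA hAΘ hAS]
  refine Eq.trans ?_ hfubini.symm
  rw [map_pair_apply hB hτ hpβ hBdens hA]
  -- The conditional density is now available for Lebesgue-almost every `β` in `Θβ` with `pβ β ≠ 0`;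
  -- where `pβ β = 0`, both integrands vanish.
  rw [hBdens, ae_withDensity_iff hpβ] at hTdens
  refine lintegral_congr_ae ?_
  filter_upwards [hTdens] with β hβ
  by_cases hβS : β ∈ S
  · have hcont : Continuous fun t : W => chart g s T (WithLp.toLp 2 (β, t)) :=
      continuous_iff_continuousAt.2 fun t => (hasFDerivAt_chart_slice β t).continuousAt
    have hDβ : MeasurableSet {t : W | jointChart g s T (WithLp.toLp 2 (β, t)) ∈ A} :=
      (measurable_pair.comp (measurable_const.prodMk hcont.measurable)) hA
    have hright : ∫⁻ t, D.indicator I (MeasurableEquiv.toLp 2 (E p × W) (β, t)) =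
        ∫⁻ t in {t : W | jointChart g s T (WithLp.toLp 2 (β, t)) ∈ A}, pβ β *
          (ENNReal.ofReal (chartSlice g s T β).toLinearMap.normDet *
            pcond β (chart g s T (WithLp.toLp 2 (β, t)))) := by
      rw [← lintegral_indicator hDβ]
      refine lintegral_congr fun t => ?_
      by_cases ht : WithLp.toLp 2 (β, t) ∈ D
      · rw [indicator_of_mem (show t ∈ {t : W | jointChart g s T (WithLp.toLp 2 (β, t)) ∈ A}
          from ht)]
        exact (indicator_of_mem ht I).trans (mul_left_comm _ _ _)
      · rw [indicator_of_notMem (show t ∉ {t : W | jointChart g s T (WithLp.toLp 2 (β, t)) ∈ A}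
          from ht)]
        exact indicator_of_notMem ht I
    have hpc : Measurable fun t : W => pcond β (chart g s T (WithLp.toLp 2 (β, t))) :=
      hpcond.comp (measurable_const.prodMk hcont.measurable)
    rw [hright, lintegral_const_mul _ (hpc.const_mul _)]
    by_cases h0 : pβ β = 0
    · simp [h0]
    · rw [hβ h0 (hSΘ hβS), withDensity_slice_apply (hu β hβS) hA hAΘ]
  · have hempty : {θ : E m | pair β θ ∈ A} = ∅ :=
      eq_empty_of_forall_notMem fun θ hθ => hβS (hAS _ hθ)
    have hnot : ∀ t, MeasurableEquiv.toLp 2 (E p × W) (β, t) ∉ D := fun t h => hβS (hDS h)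
    have hzero : ∀ t, D.indicator I (MeasurableEquiv.toLp 2 (E p × W) (β, t)) = 0 := fun t =>
      indicator_of_notMem (hnot t) I
    rw [hempty, measure_empty, mul_zero]
    exact (lintegral_eq_zero_of_ae_eq_zero (ae_of_all _ hzero)).symm

end MomentModel
end

/-! ### Existence of charts, and passage from local to global. -/

noncomputable section

namespace MomentModel

open Module Set Filter

variable {d p m : ℕ} {g : E d → E p → E p} {s : Fin (m + 1) → E d} {Θβ : Set (E p)}

/-- Coordinates of `ℝ^m` adapted to the splitting of `H_β` into `ker H_β` and its complement. -/
theorem exists_frame_eq_one {β : E p} (hH : (H g s β).rank = p) :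
    ∃ T : WithLp 2 (E p × (slopeMap g s β).ker) ≃L[ℝ] E m, frame g s T β = 1 := by
  set h := slopeMap g s β
  let π : E m →L[ℝ] h.ker := h.ker.orthogonalProjectionOnto
  have hπ : (π : E m →ₗ[ℝ] h.ker).range = ⊤ := LinearMap.range_eq_top.2 fun v =>
    ⟨v, h.ker.orthogonalProjectionOnto_mem_subspace_eq_self v⟩
  have hcompl : IsCompl h.ker π.ker := by
    rw [h.ker.ker_orthogonalProjectionOnto]
    exact h.ker.isCompl_orthogonal
  -- `e` is `H_β` paired with orthogonal projection onto its kernel. Taking `T` to be its inverse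
  -- makes the frame at `β` the identity.
  let e : E m ≃L[ℝ] E p × h.ker := ContinuousLinearMap.equivProdOfSurjectiveOfIsCompl h π
    (LinearMap.range_eq_top.2 (slopeMap_surjective hH)) hπ hcompl
  refine ⟨(WithLp.prodContinuousLinearEquiv 2 ℝ (E p) h.ker).trans e.symm, ?_⟩
  ext1 θ
  exact e.symm_apply_apply θ

/-- Near each `β ∈ Θ_β` a single chart covers the parameter space. -/
theorem exists_nhdsWithin_isUnit_frame (hΘβ : MeasurableSet Θβ)
    (hg : ∀ j, ∀ β ∈ Θβ, ContDiffAt ℝ 1 (g (s j)) β)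
    {β : E p} (hβ : β ∈ Θβ) (hH : (H g s β).rank = p) :
    ∃ T : WithLp 2 (E p × (slopeMap g s β).ker) ≃L[ℝ] E m, ∃ S ∈ 𝓝[Θβ] β,
      MeasurableSet S ∧ S ⊆ Θβ ∧ ∀ β' ∈ S, IsUnit (frame g s T β') := by
  obtain ⟨T, hT⟩ := exists_frame_eq_one hH
  have hcont : ContinuousOn (frame g s T) Θβ := fun β' hβ' =>
    (contDiffAt_frame fun j => hg j β' hβ').continuousAt.continuousWithinAt
  refine ⟨T, Θβ ∩ frame g s T ⁻¹' {x | IsUnit x}, ?_, ?_, inter_subset_left, fun β' h => h.2⟩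
  · refine inter_mem self_mem_nhdsWithin (hcont β hβ (Units.isOpen.mem_nhds ?_))
    rw [hT]
    exact isUnit_one
  · borelize (E m →L[ℝ] E m)
    exact hcont.measurableSet_inter_preimage hΘβ Units.isOpen.measurableSet

/-- The two measures agree over each chart neighbourhood, hence over a countable union of them that
covers the parameter space. -/
theorem restrict_map_pair_eq_withDensity {Ω : Type*} [MeasurableSpace Ω] {P : Measure Ω}
    [IsProbabilityMeasure P] (hΘβ : MeasurableSet Θβ)
    (hg : ∀ j, ∀ β ∈ Θβ, ContDiffAt ℝ 1 (g (s j)) β)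
    (hH : ∀ β ∈ Θβ, (H g s β).rank = p) {Jθ : E p → E m → Matrix (Fin p) (Fin m) ℝ}
    (hJ : ∀ β θ, pair β θ ∈ paramSpace g s Θβ → IsBetaJacobian g s β θ (Jθ β θ))
    {B : Ω → E p} (hB : Measurable B) {τ : Ω → E m} (hτ : Measurable τ)
    {pβ : E p → ℝ≥0∞} (hpβ : Measurable pβ) (hBdens : P.map B = volume.withDensity pβ)
    {pcond : E p → E m → ℝ≥0∞} (hpcond : Measurable (Function.uncurry pcond))
    (hTdens : ∀ᵐ β ∂(P.map B), β ∈ Θβ →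
      condDistrib τ B P β = (μHE[m - p].restrict (slice g s β)).withDensity (pcond β)) :
    (P.map fun ω => pair (B ω) (τ ω)).restrict (paramSpace g s Θβ) =
      (μHE[m].restrict (paramSpace g s Θβ)).withDensity (jointDensity Jθ pβ pcond) := by
  have hPS := measurableSet_paramSpace (s := s) hΘβ hg
  have hchart : ∀ β ∈ Θβ, ∃ S ∈ 𝓝[Θβ] β, MeasurableSet S ∧
      ∀ A : Set (Joint p m), MeasurableSet A → A ⊆ paramSpace g s Θβ → (∀ x ∈ A, x.fst ∈ S) →
        (P.map fun ω => pair (B ω) (τ ω)) A = ∫⁻ x in A, jointDensity Jθ pβ pcond x ∂μHE[m] := by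
    intro β hβ
    obtain ⟨T, S, hSβ, hS, hSΘ, hu⟩ := exists_nhdsWithin_isUnit_frame hΘβ hg hβ (hH β hβ)
    exact ⟨S, hSβ, hS, fun A hA hAΘ hAS => map_pair_apply_eq_lintegral_jointDensity hB hτ hpβ
      hBdens hpcond hTdens hS hSΘ hg hH hJ hu hA hAΘ hAS⟩
  choose! S hSβ hS hSeq using hchart
  -- Lindelöf property of `Θβ`.
  obtain ⟨t, htΘ, htc, hcover⟩ := TopologicalSpace.countable_cover_nhdsWithin hSβ
  have := htc.to_subtype
  have hfst : Measurable fun x : Joint p m => x.fst :=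
    (WithLp.prod_continuous_ofLp 2 _ _).fst.measurable
  have hlocal := (Measure.restrict_iUnion_congr
    (μ := (P.map fun ω => pair (B ω) (τ ω)).restrict (paramSpace g s Θβ))
    (ν := (μHE[m].restrict (paramSpace g s Θβ)).withDensity (jointDensity Jθ pβ pcond))
    (s := fun β : t => {x : Joint p m | x.fst ∈ S β})).2 fun β => by
      have hβ := htΘ β.2
      have hSx : MeasurableSet {x : Joint p m | x.fst ∈ S β} := hfst (hS β hβ)
      ext A hA
      have hAS := hA.inter hSx
      rw [Measure.restrict_apply hA, Measure.restrict_apply hA, Measure.restrict_apply hAS,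
        withDensity_apply _ hAS, Measure.restrict_restrict hAS]
      exact hSeq β hβ _ (hAS.inter hPS) inter_subset_right fun x hx => hx.1.2
  have hsub : paramSpace g s Θβ ⊆ ⋃ β : t, {x : Joint p m | x.fst ∈ S β} := fun x hx => by
    obtain ⟨β, hβ, hxβ⟩ := mem_iUnion₂.1 (hcover hx.1)
    exact mem_iUnion.2 ⟨⟨β, hβ⟩, hxβ⟩
  have hae : ∀ᵐ x ∂μHE[m].restrict (paramSpace g s Θβ),
      x ∈ ⋃ β : t, {x : Joint p m | x.fst ∈ S β} := (ae_restrict_mem hPS).mono fun x hx => hsub hx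
  have hae' : ∀ᵐ x ∂(P.map fun ω => pair (B ω) (τ ω)).restrict (paramSpace g s Θβ),
      x ∈ ⋃ β : t, {x : Joint p m | x.fst ∈ S β} := (ae_restrict_mem hPS).mono fun x hx => hsub hx
  rwa [Measure.restrict_eq_self_of_ae_mem hae', Measure.restrict_eq_self_of_ae_mem
    ((withDensity_absolutelyContinuous _ _).ae_le hae)] at hlocal

end MomentModel

end

/-! ### The density, the almost sure case and uniqueness. -/

open MomentModel in
theorem proposition2 {Ω : Type*} [MeasurableSpace Ω] (P : Measure Ω) [IsProbabilityMeasure P]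
    {d p m : ℕ} (g : E d → E p → E p) (s : Fin (m + 1) → E d)
    (Θβ : Set (E p)) (hΘβ : MeasurableSet Θβ)
    (hg : ∀ j, ∀ β ∈ Θβ, ContDiffAt ℝ 1 (g (s j)) β)
    (hH : ∀ β ∈ Θβ, (H g s β).rank = p)
    (Jθ : E p → E m → Matrix (Fin p) (Fin m) ℝ)
    (hJ : ∀ β θ, pair β θ ∈ paramSpace g s Θβ → IsBetaJacobian g s β θ (Jθ β θ))
    (B : Ω → E p) (hB : Measurable B) (T : Ω → E m) (hT : Measurable T)
    (pβ : E p → ℝ≥0∞) (hpβ : Measurable pβ)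
    (hBdens : P.map B = volume.withDensity pβ)
    (pcond : E p → E m → ℝ≥0∞) (hpcond : Measurable (Function.uncurry pcond))
    (hTdens : ∀ᵐ β ∂(P.map B), β ∈ Θβ →
      condDistrib T B P β = (μHE[m - p].restrict (slice g s β)).withDensity (pcond β)) :
    AEMeasurable (jointDensity Jθ pβ pcond) (μHE[m].restrict (paramSpace g s Θβ)) ∧
    (P.map fun ω => pair (B ω) (T ω)).restrict (paramSpace g s Θβ) =
      (μHE[m].restrict (paramSpace g s Θβ)).withDensity (jointDensity Jθ pβ pcond) ∧
    ((∀ᵐ ω ∂P, pair (B ω) (T ω) ∈ paramSpace g s Θβ) →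
      (P.map fun ω => pair (B ω) (T ω)) =
        (μHE[m].restrict (paramSpace g s Θβ)).withDensity (jointDensity Jθ pβ pcond)) ∧
    ∀ q : Joint p m → ℝ≥0∞, AEMeasurable q (μHE[m].restrict (paramSpace g s Θβ)) →
      (P.map fun ω => pair (B ω) (T ω)).restrict (paramSpace g s Θβ) =
        (μHE[m].restrict (paramSpace g s Θβ)).withDensity q →
      q =ᵐ[μHE[m].restrict (paramSpace g s Θβ)] jointDensity Jθ pβ pcond := by

  have hmeas := aemeasurable_jointDensity hΘβ hg hH hJ hpβ hpcond μHE[m]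
  have heq := restrict_map_pair_eq_withDensity hΘβ hg hH hJ hB hT hpβ hBdens hpcond hTdens
  have hpair : Measurable fun ω => pair (B ω) (T ω) := measurable_pair.comp (hB.prodMk hT)
  refine ⟨hmeas, heq, fun hae => ?_, fun q hq hqeq => ?_⟩
  · rw [← heq, Measure.restrict_eq_self_of_ae_mem]
    exact (ae_map_iff hpair.aemeasurable (measurableSet_paramSpace hΘβ hg)).2 hae
  -- Equal measures have a.e. equal densities once one integral is finite; that of `q` is the mass
  -- of a restricted probability law.
  · refine (withDensity_eq_iff hq hmeas ?_).1 (hqeq.symm.trans heq)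
    have := Measure.isProbabilityMeasure_map (μ := P) hpair.aemeasurable
    rw [← setLIntegral_univ, ← withDensity_apply _ MeasurableSet.univ, ← hqeq]
    exact measure_ne_top _ _
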